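/- All manifolds are smooth, Hausdorff, second countable, non-empty and of pure finite dimension. Let $\Gamma\rightrightarrows M$ be a Lie groupoid with source $s$, target $t$ and Lie algebroid $A=\ker s_*|_M$, with anchor $\rho=t_*|_A:A\to TM$. A quasi-Poisson structure on $\Gamma$ is a pair $(\Pi,\Lambda)$, where $\Pi$ is a multiplicative bivector field on $\Gamma$ and $\Lambda\in\Gamma(\wedge^3A)$, such that $\tfrac12[\Pi,\Pi]=\overleftarrow{\Lambda}-\overrightarrow{\Lambda}$ and $[\Pi,\overrightarrow{\Lambda}]=0$. Write $\rho_*:A^\vee\to TM$ for the restriction of $\Pi^\#:T^\vee\Gamma\to T\Gamma$ to $A^\vee\subset T^\vee\Gamma|_M$, and $\rho^\vee:T^\vee M\to A^\vee$, $\rho_*^\vee:T^\vee M\to A$ for the transposes of $\rho$ and $\rho_*$. The twist of $(\Pi,\Lambda)$ by $T\in\Gamma(\wedge^2A)$ is $(\Pi+\overrightarrow{T}-\overleftarrow{T},\ \Lambda-\delta_\Pi T-\tfrac12[T,T])$, where $\overrightarrow{\delta_\Pi T}=[\Pi,\overrightarrow{T}]$. A Morita morphism of quasi-Poisson groupoids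 from $(\Gamma_1,\Pi_1,\Lambda_1)$ to $(\Gamma_2,\Pi_2,\Lambda_2)$ is a morphism of Lie groupoids over a surjective submersion $M_1\to M_2$ that identifies $\Gamma_1$ with the pull-back groupoid $M_1\times_{M_2}\Gamma_2\times_{M_2}M_1$ and pushes some twist of $(\Pi_1,\Lambda_1)$ forward to $(\Pi_2,\Lambda_2)$. Two quasi-Poisson groupoids are Morita equivalent if there are Morita morphisms to both of them from a third one. A $(+1)$-shifted Poisson stack $(\mathfrak X,\mathcal P)$ is a Morita equivalence class of quasi-Poisson groupoids; its members are its presentations. Its dimension $\dim\mathfrak X=\dim M-\operatorname{rk}A$ does not depend on the presentation. The coarse moduli space $|\mathfrak X|$ is the orbit space $M/\Gamma$, and the rank of $\mathcal P$ is the well-defined function $$\operatorname{rank}\mathcal P:|\mathfrak X|\to\mathbb Z,\qquad [m]\mapsto\dim\mathfrak X-\dim\bigl(\ker\rho^\vee|_m\cap\ker\rho_*^\vee|_m\bigr).$$ A quasi-Poisson groupoid is non-degenerate if for each $m\in M$ the pair $(-\rho_*^\vee,\rho_*)$ is a quasi-isomorphism of 2-term complexes from $(T_m^\vee M[1]\xrightarrow{\rho^\vee}A_m^\vee)$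 to $(A_m[1]\xrightarrow{\rho}T_mM)$. The stack $(\mathfrak X,\mathcal P)$ is non-degenerate if all of its presentations are. **Proposition.** Let $(\mathfrak X,\mathcal P)$ be a $(+1)$-shifted Poisson stack. 1. If $(\mathfrak X,\mathcal P)$ is non-degenerate, then $\dim\mathfrak X=0$. 2. For every presentation of $(\mathfrak X,\mathcal P)$, the stack is non-degenerate if and only if this presentation is non-degenerate. 3. $(\mathfrak X,\mathcal P)$ is non-degenerate if and only if $\operatorname{rank}\mathcal P=\dim\mathfrak X=0$ at every point of the coarse moduli space $|\mathfrak X|$, computed in any presentation. -/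

import Mathlib

open scoped Manifold ContDiff Topology

universe u

namespace LieGroupoid

/-! Tangent vectors `w` with `df₁ w = df₂ w` are velocities of curves in `{f₁ = f₂}`, when
`df₁ - df₂` is onto. Hence a derivative within that set is determined on such vectors. -/

theorem exists_curve_in_fiber {E F : Type*} [NormedAddCommGroup E] [NormedSpace ℝ E]
    [FiniteDimensional ℝ E] [NormedAddCommGroup F] [NormedSpace ℝ F] [FiniteDimensional ℝ F]
    {f : E → F} {f' : E →L[ℝ] F} {a : E} (hf : HasStrictFDerivAt f f' a)
    (hs : Function.Surjective f') {w : E} (hw : f' w = 0) :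
    ∃ c : ℝ → E, c 0 = a ∧ HasDerivAt c w 0 ∧ ∀ᶠ τ in 𝓝 (0 : ℝ), f (c τ) = f a := by
  have : CompleteSpace E := FiniteDimensional.complete ℝ E
  have : CompleteSpace F := FiniteDimensional.complete ℝ F
  have hr : f'.range = ⊤ := LinearMap.range_eq_top.2 hs
  let w' : f'.ker := ⟨w, hw⟩
  let ℓ : ℝ → f'.ker := fun τ => τ • w'
  have hℓ : HasDerivAt ℓ w' 0 := by
    simpa using (hasDerivAt_id (0 : ℝ)).smul_const w'
  have hi := hf.to_implicitFunction hr
  have h0 : ℓ 0 = 0 := by simp [ℓ]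
  refine ⟨fun τ => hf.implicitFunction f f' hr (f a) (ℓ τ), ?_, ?_, ?_⟩
  · simp only [h0]; exact hf.implicitFunction_apply_image hr
  · have := (h0 ▸ hi.hasFDerivAt : HasFDerivAt (hf.implicitFunction f f' hr (f a)) _ (ℓ 0)).comp_hasDerivAt 0 hℓ
    have e : (f'.ker.subtypeL) w' = w := rfl
    rw [e] at this
    exact this
  · have h := hf.map_implicitFunction_eq hr
    have hc : Filter.Tendsto (fun τ : ℝ => (f a, ℓ τ)) (𝓝 0) (𝓝 (f a, (0 : f'.ker))) := by
      have : ContinuousAt (fun τ : ℝ => (f a, ℓ τ)) 0 := continuousAt_const.prodMk hℓ.continuousAt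
      simpa [ContinuousAt, h0] using this
    exact hc.eventually h

section
variable {E E' E'' : Type*} [NormedAddCommGroup E] [NormedSpace ℝ E] [FiniteDimensional ℝ E]
  [NormedAddCommGroup E'] [NormedSpace ℝ E'] [FiniteDimensional ℝ E']
  [NormedAddCommGroup E''] [NormedSpace ℝ E'']
  {H H' H'' : Type*} [TopologicalSpace H] [TopologicalSpace H'] [TopologicalSpace H'']
  {I : ModelWithCorners ℝ E H} {J : ModelWithCorners ℝ E' H'} {K : ModelWithCorners ℝ E'' H''}
  [I.Boundaryless]
  {N P Q : Type*} [TopologicalSpace N] [ChartedSpace H N] [TopologicalSpace P] [ChartedSpace H' P]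
  [TopologicalSpace Q] [ChartedSpace H'' Q]

theorem exists_curve_in_equalizer {f₁ f₂ : N → P} {x : N} {D₁ D₂ : E →L[ℝ] E'} (h₁ : ContMDiffAt I J ∞ f₁ x)
    (h₂ : ContMDiffAt I J ∞ f₂ x) (hx : f₁ x = f₂ x)
    (hD₁ : mfderiv I J f₁ x = D₁) (hD₂ : mfderiv I J f₂ x = D₂)
    (hs : ∀ y : E', ∃ w : E, D₁ w - D₂ w = y) {w : E} (hw : D₁ w = D₂ w) :
    ∃ c : ℝ → N, c 0 = x ∧
      HasMFDerivAt 𝓘(ℝ, ℝ) I c 0 (ContinuousLinearMap.toSpanSingleton ℝ w) ∧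
      ∀ᶠ τ in 𝓝 (0 : ℝ), f₁ (c τ) = f₂ (c τ) := by
  set a := extChartAt I x x with ha
  set F₁ := writtenInExtChartAt I J x f₁ with hF₁
  set F₂ := writtenInExtChartAt I J x f₂ with hF₂
  have d₁ : ContDiffAt ℝ ∞ F₁ a := by
    have := (contMDiffAt_iff.1 h₁).2
    rw [I.range_eq_univ, contDiffWithinAt_univ] at this
    exact this
  have d₂ : ContDiffAt ℝ ∞ F₂ a := by
    have := (contMDiffAt_iff.1 h₂).2
    rw [I.range_eq_univ, contDiffWithinAt_univ] at this
    exact this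
  have m₁ : fderiv ℝ F₁ a = D₁ := by
    rw [← hD₁, (h₁.mdifferentiableAt (by simp)).mfderiv, I.range_eq_univ, fderivWithin_univ]
  have m₂ : fderiv ℝ F₂ a = D₂ := by
    rw [← hD₂, (h₂.mdifferentiableAt (by simp)).mfderiv, I.range_eq_univ, fderivWithin_univ]
  have st : HasStrictFDerivAt (fun y => F₁ y - F₂ y) (fderiv ℝ F₁ a - fderiv ℝ F₂ a) a :=
    (d₁.hasStrictFDerivAt (by simp)).sub (d₂.hasStrictFDerivAt (by simp))
  obtain ⟨c, c0, hc, hce⟩ := exists_curve_in_fiber st (w := w)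
    (fun y => by
      obtain ⟨w, hw⟩ := hs y
      refine ⟨w, ?_⟩
      rw [m₁, m₂]; exact hw)
    (by rw [m₁, m₂]; exact sub_eq_zero.2 hw)
  have hct : ContinuousAt c 0 := hc.continuousAt
  have htgt : ∀ᶠ τ in 𝓝 (0 : ℝ), c τ ∈ (extChartAt I x).target :=
    hct.eventually (by rw [c0]; exact extChartAt_target_mem_nhds x)
  have hcont : ContinuousAt (fun τ => (extChartAt I x).symm (c τ)) 0 := by
    have : ContinuousAt (extChartAt I x).symm (c 0) := by
      rw [c0]; exact continuousAt_extChartAt_symm x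
    exact this.comp hct
  have hx0 : (extChartAt I x).symm (c 0) = x := by rw [c0, ha]; simp
  refine ⟨fun τ => (extChartAt I x).symm (c τ), hx0, ⟨hcont, ?_⟩, ?_⟩
  · have key : HasFDerivAt c (ContinuousLinearMap.toSpanSingleton ℝ w) 0 := hc.hasFDerivAt
    have e : writtenInExtChartAt 𝓘(ℝ, ℝ) I (0 : ℝ) (fun τ => (extChartAt I x).symm (c τ))
        =ᶠ[𝓝 (0 : ℝ)] c := by
      filter_upwards [htgt] with τ hτ
      simp only [writtenInExtChartAt, Function.comp, hx0, extChartAt_model_space_eq_id,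
        PartialEquiv.refl_symm, PartialEquiv.refl_coe, id]
      exact (extChartAt I x).right_inv hτ
    have k2 := key.congr_of_eventuallyEq e
    exact k2.hasFDerivWithinAt
  · have n₁ : ∀ᶠ τ in 𝓝 (0 : ℝ), f₁ ((extChartAt I x).symm (c τ)) ∈ (extChartAt J (f₁ x)).source := by
      refine (ContinuousAt.comp (g := f₁) ?_ hcont).eventually ?_
      · rw [hx0]; exact h₁.continuousAt
      · simp only [Function.comp, hx0]; exact extChartAt_source_mem_nhds _
    have n₂ : ∀ᶠ τ in 𝓝 (0 : ℝ), f₂ ((extChartAt I x).symm (c τ)) ∈ (extChartAt J (f₁ x)).source := by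
      refine (ContinuousAt.comp (g := f₂) ?_ hcont).eventually ?_
      · rw [hx0]; exact h₂.continuousAt
      · simp only [Function.comp, hx0]; rw [hx]; exact extChartAt_source_mem_nhds _
    have e0 : F₁ a - F₂ a = 0 := by
      simp [hF₁, hF₂, writtenInExtChartAt, ha, hx]
    filter_upwards [hce, n₁, n₂] with τ e k₁ k₂
    rw [e0, sub_eq_zero] at e
    simp only [hF₁, hF₂, writtenInExtChartAt, Function.comp, ← hx] at e
    exact (extChartAt J (f₁ x)).injOn k₁ k₂ e

theorem hasMFDerivWithinAt_equalizer_eq {f₁ f₂ : N → P} {x : N} {D₁ D₂ : E →L[ℝ] E'} (h₁ : ContMDiffAt I J ∞ f₁ x)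
    (h₂ : ContMDiffAt I J ∞ f₂ x) (hx : f₁ x = f₂ x)
    (hD₁ : mfderiv I J f₁ x = D₁) (hD₂ : mfderiv I J f₂ x = D₂)
    (hs : ∀ y : E', ∃ w : E, D₁ w - D₂ w = y) {w : E} (hw : D₁ w = D₂ w)
    {Φ Ψ : N → Q} {D D' : E →L[ℝ] E''}
    (hΦ : HasMFDerivWithinAt I K Φ {p | f₁ p = f₂ p} x D) (hΨ : HasMFDerivAt I K Ψ x D')
    (he : ∀ p, f₁ p = f₂ p → Φ p = Ψ p) : D w = D' w := by
  obtain ⟨c, c0, hc, hce⟩ := exists_curve_in_equalizer h₁ h₂ hx hD₁ hD₂ hs hw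
  subst c0
  have k₁ : HasMFDerivWithinAt 𝓘(ℝ, ℝ) K (Φ ∘ c) (c ⁻¹' {p | f₁ p = f₂ p}) 0
      (D.comp (ContinuousLinearMap.toSpanSingleton ℝ w)) :=
    HasMFDerivWithinAt.comp 0 hΦ hc.hasMFDerivWithinAt subset_rfl
  have k₁' : HasMFDerivAt 𝓘(ℝ, ℝ) K (Φ ∘ c) 0
      (D.comp (ContinuousLinearMap.toSpanSingleton ℝ w)) := k₁.hasMFDerivAt hce
  have k₂ : HasMFDerivAt 𝓘(ℝ, ℝ) K (Ψ ∘ c) 0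
      (D'.comp (ContinuousLinearMap.toSpanSingleton ℝ w)) := HasMFDerivAt.comp 0 hΨ hc
  have e : (Φ ∘ c) =ᶠ[𝓝 (0 : ℝ)] (Ψ ∘ c) := by
    filter_upwards [hce] with τ h using he _ h
  have k₃ : HasMFDerivAt 𝓘(ℝ, ℝ) K (Φ ∘ c) 0
      (D'.comp (ContinuousLinearMap.toSpanSingleton ℝ w)) := by
    exact k₂.congr_of_eventuallyEq e
  have := hasMFDerivAt_unique k₁' k₃
  have := congrArg (fun L : ℝ →L[ℝ] E'' => L 1) this
  have h1 : D ((1 : ℝ) • w) = D' ((1 : ℝ) • w) := this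
  rwa [one_smul] at h1
end

end LieGroupoid

/-- A Lie groupoid `Γ ⇉ M`: smooth (Hausdorff, second countable, non-empty) manifolds `M` and `Γ`
of dimensions `dimM` and `dimΓ`, with source, target, unit, inversion and a product `mul g h`
that is meaningful for `s g = t h` (its values on other pairs are irrelevant). The source and
the target are submersions, and the product is smooth on the submanifold of composable pairs. -/
structure LieGroupoid where
  dimM : ℕ
  dimΓ : ℕ
  M : Type u
  Γ : Type u
  [topM : TopologicalSpace M]
  [chartedM : ChartedSpace (EuclideanSpace ℝ (Fin dimM)) M]
  [manifoldM : IsManifold (𝓡 dimM) ∞ M]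
  [t2M : T2Space M]
  [secondCountableM : SecondCountableTopology M]
  [nonemptyM : Nonempty M]
  [topΓ : TopologicalSpace Γ]
  [chartedΓ : ChartedSpace (EuclideanSpace ℝ (Fin dimΓ)) Γ]
  [manifoldΓ : IsManifold (𝓡 dimΓ) ∞ Γ]
  [t2Γ : T2Space Γ]
  [secondCountableΓ : SecondCountableTopology Γ]
  s : Γ → M
  t : Γ → M
  unit : M → Γ
  inv : Γ → Γ
  mul : Γ → Γ → Γ
  s_unit : ∀ m, s (unit m) = m
  t_unit : ∀ m, t (unit m) = m
  s_mul : ∀ g h, s g = t h → s (mul g h) = s h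
  t_mul : ∀ g h, s g = t h → t (mul g h) = t g
  mul_assoc : ∀ g h k, s g = t h → s h = t k → mul (mul g h) k = mul g (mul h k)
  unit_mul : ∀ g, mul (unit (t g)) g = g
  mul_unit : ∀ g, mul g (unit (s g)) = g
  s_inv : ∀ g, s (inv g) = t g
  t_inv : ∀ g, t (inv g) = s g
  inv_mul : ∀ g, mul (inv g) g = unit (s g)
  mul_inv : ∀ g, mul g (inv g) = unit (t g)
  smooth_s : ContMDiff (𝓡 dimΓ) (𝓡 dimM) ∞ s
  smooth_t : ContMDiff (𝓡 dimΓ) (𝓡 dimM) ∞ t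
  smooth_unit : ContMDiff (𝓡 dimM) (𝓡 dimΓ) ∞ unit
  smooth_inv : ContMDiff (𝓡 dimΓ) (𝓡 dimΓ) ∞ inv
  smooth_mul : ContMDiffOn ((𝓡 dimΓ).prod (𝓡 dimΓ)) (𝓡 dimΓ) ∞
    (fun p : Γ × Γ => mul p.1 p.2) {p | s p.1 = t p.2}
  submersion_s : ∀ g, Function.Surjective (mfderiv (𝓡 dimΓ) (𝓡 dimM) s g)
  submersion_t : ∀ g, Function.Surjective (mfderiv (𝓡 dimΓ) (𝓡 dimM) t g)

namespace LieGroupoid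

attribute [instance] topM chartedM manifoldM t2M secondCountableM nonemptyM
  topΓ chartedΓ manifoldΓ t2Γ secondCountableΓ

noncomputable section

variable (G : LieGroupoid.{u})

/-- The tangent space `T_m M`. -/
abbrev TM (m : G.M) : Type := TangentSpace (𝓡 G.dimM) m

/-- The tangent space `T_g Γ`. -/
abbrev TΓ (g : G.Γ) : Type := TangentSpace (𝓡 G.dimΓ) g

/-! The structure maps of the tangent groupoid `TΓ ⇉ TM`. -/

def Ts (g : G.Γ) : G.TΓ g →ₗ[ℝ] G.TM (G.s g) :=
  (mfderiv (𝓡 G.dimΓ) (𝓡 G.dimM) G.s g).toLinearMap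

def Tt (g : G.Γ) : G.TΓ g →ₗ[ℝ] G.TM (G.t g) :=
  (mfderiv (𝓡 G.dimΓ) (𝓡 G.dimM) G.t g).toLinearMap

def Tunit (m : G.M) : G.TM m →ₗ[ℝ] G.TΓ (G.unit m) :=
  (mfderiv (𝓡 G.dimM) (𝓡 G.dimΓ) G.unit m).toLinearMap

def Tinv (g : G.Γ) : G.TΓ g →ₗ[ℝ] G.TΓ (G.inv g) :=
  (mfderiv (𝓡 G.dimΓ) (𝓡 G.dimΓ) G.inv g).toLinearMap

/-- The product of the tangent groupoid, on vectors `u ∈ T_g Γ`, `v ∈ T_h Γ` with `s_* u = t_* v`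
(`s g = t h`). The derivative is taken within the submanifold of composable pairs, so only its
values on such pairs `(u, v)`, which are the tangent vectors of that submanifold, are meaningful;
only these are used below. -/
def Tmul (g h : G.Γ) : G.TΓ g × G.TΓ h →ₗ[ℝ] G.TΓ (G.mul g h) :=
  (mfderivWithin ((𝓡 G.dimΓ).prod (𝓡 G.dimΓ)) (𝓡 G.dimΓ)
    (fun p : G.Γ × G.Γ => G.mul p.1 p.2) {p | G.s p.1 = G.t p.2} (g, h)).toLinearMap

/-- `s_*` at the unit `1_m`, as a map to `T_m M`; recall that `s 1_m = m`, and a tangent space is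
the model space read in the preferred chart at the point. -/
def TsUnit (m : G.M) : G.TΓ (G.unit m) →ₗ[ℝ] G.TM m := G.Ts (G.unit m)

/-- `t_*` at the unit `1_m`, as a map to `T_m M`. -/
def TtUnit (m : G.M) : G.TΓ (G.unit m) →ₗ[ℝ] G.TM m := G.Tt (G.unit m)

/-- `s_* u = t_* v`, for a composable pair of arrows `g`, `h`. -/
def TComposable (g h : G.Γ) (u : G.TΓ g) (v : G.TΓ h) : Prop :=
  (G.Ts g u : EuclideanSpace ℝ (Fin G.dimM)) = G.Tt h v

variable {G}

theorem hasMFDerivWithinAt_mul {g h : G.Γ} (hgh : G.s g = G.t h) :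
    HasMFDerivWithinAt ((𝓡 G.dimΓ).prod (𝓡 G.dimΓ)) (𝓡 G.dimΓ)
      (fun p : G.Γ × G.Γ => G.mul p.1 p.2) {p | G.s p.1 = G.t p.2} (g, h)
      (mfderivWithin ((𝓡 G.dimΓ).prod (𝓡 G.dimΓ)) (𝓡 G.dimΓ)
    (fun p : G.Γ × G.Γ => G.mul p.1 p.2) {p | G.s p.1 = G.t p.2} (g, h)) :=
  ((G.smooth_mul (g, h) hgh).mdifferentiableWithinAt (by simp)).hasMFDerivWithinAt

theorem tangent_comp_eq {n : ℕ} {Q : Type*} [TopologicalSpace Q]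
    [ChartedSpace (EuclideanSpace ℝ (Fin n)) Q] {g h : G.Γ} (hgh : G.s g = G.t h)
    {F : G.Γ → Q} {K : G.Γ × G.Γ → Q}
    {D : EuclideanSpace ℝ (Fin G.dimΓ) →L[ℝ] EuclideanSpace ℝ (Fin n)}
    {D' : EuclideanSpace ℝ (Fin G.dimΓ) × EuclideanSpace ℝ (Fin G.dimΓ) →L[ℝ]
      EuclideanSpace ℝ (Fin n)}
    (hF : HasMFDerivAt (𝓡 G.dimΓ) (𝓡 n) F (G.mul g h) D)
    (hK : HasMFDerivAt ((𝓡 G.dimΓ).prod (𝓡 G.dimΓ)) (𝓡 n) K (g, h) D')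
    (he : ∀ p : G.Γ × G.Γ, G.s p.1 = G.t p.2 → F (G.mul p.1 p.2) = K p)
    {u : G.TΓ g} {v : G.TΓ h} (huv : G.TComposable g h u v) :
    D (G.Tmul g h (u, v)) = D' (u, v) := by
  have hs' : HasMFDerivAt ((𝓡 G.dimΓ).prod (𝓡 G.dimΓ)) (𝓡 G.dimM)
      (fun p : G.Γ × G.Γ => G.s p.1) (g, h) _ :=
    HasMFDerivAt.comp (g, h)
      ((G.smooth_s.mdifferentiable (by simp)) g).hasMFDerivAt (hasMFDerivAt_fst (g, h))
  have ht' : HasMFDerivAt ((𝓡 G.dimΓ).prod (𝓡 G.dimΓ)) (𝓡 G.dimM)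
      (fun p : G.Γ × G.Γ => G.t p.2) (g, h) _ :=
    HasMFDerivAt.comp (g, h)
      ((G.smooth_t.mdifferentiable (by simp)) h).hasMFDerivAt (hasMFDerivAt_snd (g, h))
  exact hasMFDerivWithinAt_equalizer_eq (I := (𝓡 G.dimΓ).prod (𝓡 G.dimΓ)) (J := 𝓡 G.dimM)
    (K := 𝓡 n) (f₁ := fun p : G.Γ × G.Γ => G.s p.1) (f₂ := fun p : G.Γ × G.Γ => G.t p.2)
    (x := (g, h)) (w := (u, v))
    (G.smooth_s.comp contMDiff_fst).contMDiffAt (G.smooth_t.comp contMDiff_snd).contMDiffAt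
    hgh hs'.mfderiv ht'.mfderiv
    (fun y => by
      obtain ⟨w, hw⟩ := G.submersion_s g y
      refine ⟨(w, 0), ?_⟩
      have h0 : mfderiv (𝓡 G.dimΓ) (𝓡 G.dimM) G.t h (0 : EuclideanSpace ℝ (Fin G.dimΓ)) = 0 :=
        map_zero _
      exact (congrArg₂ (fun a b : EuclideanSpace ℝ (Fin G.dimM) => a - b) hw h0).trans
        (sub_zero y)) huv
    (Φ := F ∘ fun p : G.Γ × G.Γ => G.mul p.1 p.2) (Ψ := K)
    (HasMFDerivWithinAt.comp (g, h) hF.hasMFDerivWithinAt (hasMFDerivWithinAt_mul hgh)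
      (Set.subset_preimage_univ)) hK he

theorem Ts_Tmul {g h : G.Γ} (hgh : G.s g = G.t h) {u : G.TΓ g} {v : G.TΓ h}
    (huv : G.TComposable g h u v) :
    (G.Ts _ (G.Tmul g h (u, v)) : EuclideanSpace ℝ (Fin G.dimM)) = G.Ts h v :=
  tangent_comp_eq hgh ((G.smooth_s.mdifferentiable (by simp)) (G.mul g h)).hasMFDerivAt
    (HasMFDerivAt.comp (g, h)
      ((G.smooth_s.mdifferentiable (by simp)) h).hasMFDerivAt (hasMFDerivAt_snd (g, h)))
    (fun p hp => G.s_mul _ _ hp) huv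

theorem Tt_Tmul {g h : G.Γ} (hgh : G.s g = G.t h) {u : G.TΓ g} {v : G.TΓ h}
    (huv : G.TComposable g h u v) :
    (G.Tt _ (G.Tmul g h (u, v)) : EuclideanSpace ℝ (Fin G.dimM)) = G.Tt g u :=
  tangent_comp_eq hgh ((G.smooth_t.mdifferentiable (by simp)) (G.mul g h)).hasMFDerivAt
    (HasMFDerivAt.comp (g, h)
      ((G.smooth_t.mdifferentiable (by simp)) g).hasMFDerivAt (hasMFDerivAt_fst (g, h)))
    (fun p hp => G.t_mul _ _ hp) huv

theorem TsUnit_Tunit (m : G.M) (w : G.TM m) : G.TsUnit m (G.Tunit m w) = w := by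
  have h := HasMFDerivAt.comp m
    ((G.smooth_s.mdifferentiable (by simp)) (G.unit m)).hasMFDerivAt
    ((G.smooth_unit.mdifferentiable (by simp)) m).hasMFDerivAt
  have e : G.s ∘ G.unit = id := funext G.s_unit
  rw [e] at h
  exact congrArg (fun L : EuclideanSpace ℝ (Fin G.dimM) →L[ℝ] EuclideanSpace ℝ (Fin G.dimM) => L w)
    (hasMFDerivAt_unique h (hasMFDerivAt_id m))

theorem TtUnit_Tunit (m : G.M) (w : G.TM m) : G.TtUnit m (G.Tunit m w) = w := by
  have h := HasMFDerivAt.comp m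
    ((G.smooth_t.mdifferentiable (by simp)) (G.unit m)).hasMFDerivAt
    ((G.smooth_unit.mdifferentiable (by simp)) m).hasMFDerivAt
  have e : G.t ∘ G.unit = id := funext G.t_unit
  rw [e] at h
  exact congrArg (fun L : EuclideanSpace ℝ (Fin G.dimM) →L[ℝ] EuclideanSpace ℝ (Fin G.dimM) => L w)
    (hasMFDerivAt_unique h (hasMFDerivAt_id m))

variable (G)

instance (m : G.M) : FiniteDimensional ℝ (G.TM m) :=
  inferInstanceAs (FiniteDimensional ℝ (EuclideanSpace ℝ (Fin G.dimM)))

instance (g : G.Γ) : FiniteDimensional ℝ (G.TΓ g) :=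
  inferInstanceAs (FiniteDimensional ℝ (EuclideanSpace ℝ (Fin G.dimΓ)))

/-- The fibre at `m` of the Lie algebroid `A = ker s_*|_M`. -/
def A (m : G.M) : Submodule ℝ (G.TΓ (G.unit m)) := LinearMap.ker (G.TsUnit m)

/-- The anchor `ρ : A → TM`, the restriction of `t_*`. -/
def anchor (m : G.M) : G.A m →ₗ[ℝ] G.TM m := G.TtUnit m ∘ₗ (G.A m).subtype

/-- The projection of `T_{1_m} Γ = T_m M ⊕ A_m` to `A_m`. Its transpose embeds `A_m^∨` into
`T_{1_m}^∨ Γ` as the annihilator of `T_m M`. -/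
def projA (m : G.M) : G.TΓ (G.unit m) →ₗ[ℝ] G.A m :=
  LinearMap.codRestrict (G.A m) (LinearMap.id - G.Tunit m ∘ₗ G.TsUnit m) fun v => by
    simp [A, TsUnit_Tunit]

/-- The rank of the vector bundle `A`; the source map is a submersion. -/
def rkA : ℤ := (G.dimΓ : ℤ) - G.dimM

/-- The dimension of the stack presented by the groupoid: `dim M - rk A`. -/
def dim : ℤ := (G.dimM : ℤ) - G.rkA

/-- Fields of `k`-vectors on `Γ`; an element of `Λ^k V` is viewed as an alternating `k`-linear form
on `V^∨`. -/
abbrev PolyVector (k : ℕ) := ∀ g : G.Γ, (Module.Dual ℝ (G.TΓ g)) [⋀^Fin k]→ₗ[ℝ] ℝ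

/-- Sections of `Λ^k A`. -/
abbrev ASection (k : ℕ) := ∀ m : G.M, (Module.Dual ℝ (G.A m)) [⋀^Fin k]→ₗ[ℝ] ℝ

/-- The differential of a function at `g`. -/
def d (f : G.Γ → ℝ) (g : G.Γ) : Module.Dual ℝ (G.TΓ g) :=
  (mfderiv (𝓡 G.dimΓ) 𝓘(ℝ, ℝ) f g).toLinearMap

variable {G}

/-- Smooth real functions on `Γ`. -/
def SmoothFun (f : G.Γ → ℝ) : Prop := ContMDiff (𝓡 G.dimΓ) 𝓘(ℝ, ℝ) ∞ f

/-- Smoothness, tested on differentials of smooth functions (these span the cotangent spaces). -/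
def PolyVector.IsSmooth {k : ℕ} (P : G.PolyVector k) : Prop :=
  ∀ f : Fin k → G.Γ → ℝ, (∀ i, SmoothFun (f i)) → SmoothFun fun g => P g fun i => G.d (f i) g

/-- Smoothness, tested on restrictions to `A` of differentials of smooth functions on `Γ`. -/
def ASection.IsSmooth {k : ℕ} (a : G.ASection k) : Prop :=
  ∀ f : Fin k → G.Γ → ℝ, (∀ i, SmoothFun (f i)) →
    ContMDiff (𝓡 G.dimM) 𝓘(ℝ, ℝ) ∞ fun m =>
      a m fun i => G.d (f i) (G.unit m) ∘ₗ (G.A m).subtype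

/-- `(a, b, c)` annihilates the tangent space at `(g, h, gh)` of the graph of the product, which
consists of the vectors `(u, v, u · v)`. -/
def IsConormal (g h : G.Γ) (a : Module.Dual ℝ (G.TΓ g)) (b : Module.Dual ℝ (G.TΓ h))
    (c : Module.Dual ℝ (G.TΓ (G.mul g h))) : Prop :=
  ∀ u v, G.TComposable g h u v → a u + b v + c (G.Tmul g h (u, v)) = 0

/-- `P` is multiplicative: the graph of the product is coisotropic with respect to
`P ⊕ P ⊕ (-1)^(k+1) P`. -/
def PolyVector.IsMultiplicative {k : ℕ} (P : G.PolyVector k) : Prop :=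
  ∀ g h, G.s g = G.t h → ∀ (a : Fin k → Module.Dual ℝ (G.TΓ g))
    (b : Fin k → Module.Dual ℝ (G.TΓ h)) (c : Fin k → Module.Dual ℝ (G.TΓ (G.mul g h))),
    (∀ i, IsConormal g h (a i) (b i) (c i)) →
      P g a + P h b + (-1) ^ (k + 1) * P (G.mul g h) c = 0

/-- `A_{t g} → T_g Γ`, `c ↦ c · 0_g`. -/
def rightTranslation (G : LieGroupoid.{u}) (g : G.Γ) : G.A (G.t g) →ₗ[ℝ] G.TΓ g :=
  (G.Tmul (G.unit (G.t g)) g ∘ₗ LinearMap.inl ℝ _ _) ∘ₗ (G.A (G.t g)).subtype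

/-- `A_{s g} → T_g Γ`, `c ↦ - 0_g · c⁻¹`. -/
def leftTranslation (G : LieGroupoid.{u}) (g : G.Γ) : G.A (G.s g) →ₗ[ℝ] G.TΓ g :=
  -(G.Tmul g (G.inv (G.unit (G.s g))) ∘ₗ LinearMap.inr ℝ _ _ ∘ₗ G.Tinv (G.unit (G.s g)) ∘ₗ
    (G.A (G.s g)).subtype)

/-- The right-invariant `k`-vector field of a section of `Λ^k A`. -/
def ASection.right {k : ℕ} (a : G.ASection k) : G.PolyVector k := fun g =>
  (a (G.t g)).compLinearMap (G.rightTranslation g).dualMap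

/-- The left-invariant `k`-vector field of a section of `Λ^k A`. -/
def ASection.left {k : ℕ} (a : G.ASection k) : G.PolyVector k := fun g =>
  (a (G.s g)).compLinearMap (G.leftTranslation g).dualMap

/-- For multiderivations `P`, `Q` of degrees `p + 1` and `q`, the function
`∑ sgn σ · P (Q (f_σ(1), …, f_σ(q)), f_σ(q+1), …, f_σ(q+p))`, the sum being over
`(q, p)`-shuffles; it is written as a sum over all permutations, divided by `q! p!`. -/
def PolyVector.insert {p q n : ℕ} (P : G.PolyVector (p + 1)) (Q : G.PolyVector q)
    (h : q + p = n) (f : Fin n → G.Γ → ℝ) (g : G.Γ) : ℝ :=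
  ((q.factorial : ℝ) * (p.factorial : ℝ))⁻¹ *
    ∑ σ : Equiv.Perm (Fin n), ((Equiv.Perm.sign σ : ℤ) : ℝ) *
      P g (Fin.cons
        (G.d (fun x => Q x fun i => G.d (f (σ (Fin.cast h (Fin.castAdd p i)))) x) g)
        (fun j => G.d (f (σ (Fin.cast h (Fin.natAdd q j)))) g))

/-- The Schouten bracket of fields of degrees `p + 1` and `q + 1`, evaluated on functions:
`[P, Q] = P ∘ Q - (-1)^(p q) Q ∘ P`. -/
def schouten {p q : ℕ} (P : G.PolyVector (p + 1)) (Q : G.PolyVector (q + 1))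
    (f : Fin (p + q + 1) → G.Γ → ℝ) (g : G.Γ) : ℝ :=
  P.insert Q (by omega) f g - (-1) ^ (p * q) * Q.insert P (by omega) f g

/-- Quasi-Poisson structures `(Π, Λ)`: `½ [Π, Π]` is the left-invariant minus the right-invariant
field of `Λ`, and `δ_Π Λ = 0`, that is, the bracket of `Π` with the right-invariant field of `Λ`
is zero. -/
structure QuasiPoissonStructure (G : LieGroupoid.{u}) where
  Pi : G.PolyVector 2
  Lam : G.ASection 3
  smooth_Pi : Pi.IsSmooth
  smooth_Lam : Lam.IsSmooth
  multiplicative : Pi.IsMultiplicative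
  schouten_Pi : ∀ f : Fin 3 → G.Γ → ℝ, (∀ i, SmoothFun (f i)) → ∀ g,
    (1 / 2) * schouten (p := 1) (q := 1) Pi Pi f g =
      Lam.left g (fun i => G.d (f i) g) - Lam.right g (fun i => G.d (f i) g)
  closed : ∀ f : Fin 4 → G.Γ → ℝ, (∀ i, SmoothFun (f i)) → ∀ g,
    schouten (p := 1) (q := 2) Pi Lam.right f g = 0

/-- `S'` is the twist of `S` by `T`: `Π' = Π + dT`, where `dT` is the right-invariant minus the
left-invariant field of `T`, and `Λ' = Λ - δ_Π T - ½ [T, T]`. Elements of `Λ^3 A` are compared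
through their right-invariant fields; the right-invariant fields of `δ_Π T` and `[T, T]` are the
brackets of `Π` and of the right-invariant field of `T` with the latter. -/
def IsTwist (T : G.ASection 2) (S S' : G.QuasiPoissonStructure) : Prop :=
  (∀ g, S'.Pi g = S.Pi g + (T.right g - T.left g)) ∧
  ∀ f : Fin 3 → G.Γ → ℝ, (∀ i, SmoothFun (f i)) → ∀ g,
    S'.Lam.right g (fun i => G.d (f i) g) = S.Lam.right g (fun i => G.d (f i) g)
      - schouten (p := 1) (q := 1) S.Pi T.right f g
      - (1 / 2) * schouten (p := 1) (q := 1) T.right T.right f g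

theorem vecTwo_eq_update {V : Type*} [Zero V] (ξ x : V) :
    ![ξ, x] = Function.update ![ξ, 0] 1 x := by
  ext i : 1
  fin_cases i <;> simp

/-- `Π^# : T^∨ Γ → TΓ`, `⟨η, Π^# ξ⟩ = Π(ξ, η)`. -/
def PolyVector.sharp (P : G.PolyVector 2) (g : G.Γ) : Module.Dual ℝ (G.TΓ g) →ₗ[ℝ] G.TΓ g :=
  (Module.evalEquiv ℝ (G.TΓ g)).symm.toLinearMap ∘ₗ
    LinearMap.mk₂ ℝ (fun ξ η => P g ![ξ, η])
      (fun ξ ξ' η => (P g).map_vecCons_add _ _ _) (fun c ξ η => (P g).map_vecCons_smul _ _ _)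
      (fun ξ η η' => by
        rw [vecTwo_eq_update ξ (η + η'), (P g).map_update_add, ← vecTwo_eq_update,
          ← vecTwo_eq_update])
      (fun c ξ η => by
        rw [vecTwo_eq_update ξ (c • η), (P g).map_update_smul, ← vecTwo_eq_update])

theorem PolyVector.apply_sharp (P : G.PolyVector 2) (g : G.Γ) (ξ η : Module.Dual ℝ (G.TΓ g)) :
    η (P.sharp g ξ) = P g ![ξ, η] := by
  simp [PolyVector.sharp]

/-- `ρ_* : A_m^∨ → T_m M`, the restriction of `Π^#` to `A^∨`. For multiplicative `Π` the vector
`Π^# ξ` is tangent to the unit submanifold `M`, and `s_*` reads it as an element of `T_m M`. -/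
def PolyVector.rhoStar (P : G.PolyVector 2) (m : G.M) :
    Module.Dual ℝ (G.A m) →ₗ[ℝ] G.TM m :=
  G.TsUnit m ∘ₗ P.sharp (G.unit m) ∘ₗ (G.projA m).dualMap

/-- The transpose `ρ_*^∨ : T_m^∨ M → A_m`. -/
def PolyVector.rhoStarDual (P : G.PolyVector 2) (m : G.M) :
    Module.Dual ℝ (G.TM m) →ₗ[ℝ] G.A m :=
  (Module.evalEquiv ℝ (G.A m)).symm.toLinearMap ∘ₗ (P.rhoStar m).dualMap

theorem PolyVector.apply_rhoStarDual (P : G.PolyVector 2) (m : G.M) (α : Module.Dual ℝ (G.TM m))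
    (ξ : Module.Dual ℝ (G.A m)) : ξ (P.rhoStarDual m α) = α (P.rhoStar m ξ) := by
  simp [PolyVector.rhoStarDual]

/-- The orbit relation on `M`. -/
def orbitSetoid (G : LieGroupoid.{u}) : Setoid G.M where
  r m n := ∃ γ, G.s γ = m ∧ G.t γ = n
  iseqv :=
    { refl := fun m => ⟨G.unit m, G.s_unit m, G.t_unit m⟩
      symm := by
        rintro _ _ ⟨γ, rfl, rfl⟩
        exact ⟨G.inv γ, G.s_inv γ, G.t_inv γ⟩
      trans := by
        rintro _ _ _ ⟨γ, rfl, rfl⟩ ⟨δ, hδ, rfl⟩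
        exact ⟨G.mul δ γ, G.s_mul δ γ hδ, G.t_mul δ γ hδ⟩ }

/-- The orbit space `M / Γ`, the coarse moduli space of the stack. -/
def CoarseModuli (G : LieGroupoid.{u}) : Type u := Quotient G.orbitSetoid

/-- `ker ρ^∨ ∩ ker ρ_*^∨` at `m`. -/
def PolyVector.commonKer (P : G.PolyVector 2) (m : G.M) : Submodule ℝ (Module.Dual ℝ (G.TM m)) :=
  LinearMap.ker (G.anchor m).dualMap ⊓ LinearMap.ker (P.rhoStarDual m)

theorem pairing_swap (P : G.PolyVector 2) (g : G.Γ) (ξ η : Module.Dual ℝ (G.TΓ g)) :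
    P g ![ξ, η] = -P g ![η, ξ] := by
  have h := (P g).map_swap ![η, ξ] (i := 0) (j := 1) (by decide)
  rw [← h]
  congr 1
  ext i : 1
  fin_cases i <;> simp

theorem PolyVector.IsMultiplicative.two {P : G.PolyVector 2} (hP : P.IsMultiplicative)
    {g h : G.Γ} (hgh : G.s g = G.t h) {a a' : Module.Dual ℝ (G.TΓ g)}
    {b b' : Module.Dual ℝ (G.TΓ h)} {c c' : Module.Dual ℝ (G.TΓ (G.mul g h))}
    (hc : IsConormal g h a b c) (hc' : IsConormal g h a' b' c') :
    P g ![a, a'] + P h ![b, b'] - P (G.mul g h) ![c, c'] = 0 := by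
  have := hP g h hgh ![a, a'] ![b, b'] ![c, c'] (by
    intro i; fin_cases i
    · exact hc
    · exact hc')
  have e : ((-1 : ℝ)) ^ (2 + 1) = -1 := by norm_num
  rw [e, neg_one_mul] at this
  rw [sub_eq_add_neg]
  exact this

theorem pairing_zero_left (P : G.PolyVector 2) (g : G.Γ) (ξ : Module.Dual ℝ (G.TΓ g)) :
    P g ![0, ξ] = 0 := (P g).map_coord_zero 0 rfl

theorem pairing_zero_right (P : G.PolyVector 2) (g : G.Γ) (ξ : Module.Dual ℝ (G.TΓ g)) :
    P g ![ξ, 0] = 0 := (P g).map_coord_zero 1 rfl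

theorem pairing_neg_right (P : G.PolyVector 2) (g : G.Γ) (ξ η : Module.Dual ℝ (G.TΓ g)) :
    P g ![ξ, -η] = -P g ![ξ, η] := by
  rw [← P.apply_sharp, ← P.apply_sharp]; rfl

theorem pairing_add_left (P : G.PolyVector 2) (g : G.Γ) (ξ ξ' η : Module.Dual ℝ (G.TΓ g)) :
    P g ![ξ + ξ', η] = P g ![ξ, η] + P g ![ξ', η] := (P g).map_vecCons_add _ _ _

abbrev sPull (g : G.Γ) (α : Module.Dual ℝ (EuclideanSpace ℝ (Fin G.dimM))) :
    Module.Dual ℝ (G.TΓ g) := α ∘ₗ G.Ts g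

abbrev tPull (g : G.Γ) (α : Module.Dual ℝ (EuclideanSpace ℝ (Fin G.dimM))) :
    Module.Dual ℝ (G.TΓ g) := α ∘ₗ G.Tt g

theorem isConormal_s {g h : G.Γ} (hgh : G.s g = G.t h)
    (α : Module.Dual ℝ (EuclideanSpace ℝ (Fin G.dimM))) :
    IsConormal g h 0 (sPull h α) (-sPull (G.mul g h) α) := by
  intro u v huv
  have e := congrArg α (Ts_Tmul hgh huv)
  change (0 : ℝ) + α (G.Ts h v) + -(α (G.Ts _ (G.Tmul g h (u, v)))) = 0
  rw [e]; ring

theorem isConormal_t {g h : G.Γ} (hgh : G.s g = G.t h)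
    (α : Module.Dual ℝ (EuclideanSpace ℝ (Fin G.dimM))) :
    IsConormal g h (tPull g α) 0 (-tPull (G.mul g h) α) := by
  intro u v huv
  have e := congrArg α (Tt_Tmul hgh huv)
  change α (G.Tt g u) + (0 : ℝ) + -(α (G.Tt _ (G.Tmul g h (u, v)))) = 0
  rw [e]; ring

theorem isConormal_of_last (g h : G.Γ) (c : Module.Dual ℝ (G.TΓ (G.mul g h))) :
    IsConormal g h (-(c ∘ₗ G.Tmul g h ∘ₗ LinearMap.inl ℝ _ _))
      (-(c ∘ₗ G.Tmul g h ∘ₗ LinearMap.inr ℝ _ _)) c := by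
  intro u v _
  have e : G.Tmul g h (u, v) = G.Tmul g h (u, 0) + G.Tmul g h (0, v) := by
    rw [← map_add]; simp
  rw [e, map_add]
  change -c (G.Tmul g h (u, 0)) + -c (G.Tmul g h (0, v)) +
    (c (G.Tmul g h (u, 0)) + c (G.Tmul g h (0, v))) = 0
  ring

theorem pairing_t_s {P : G.PolyVector 2} (hP : P.IsMultiplicative) (k : G.Γ)
    (α β : Module.Dual ℝ (EuclideanSpace ℝ (Fin G.dimM))) :
    P k ![tPull k α, sPull k β] = 0 := by
  have key : ∀ k', G.mul k (G.unit (G.s k)) = k' → P k' ![tPull k' α, sPull k' β] = 0 := by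
    rintro _ rfl
    have h := hP.two (G.t_unit _).symm (isConormal_t (h := G.unit (G.s k)) (G.t_unit _).symm α)
      (isConormal_s (g := k) (G.t_unit _).symm β)
    rw [pairing_zero_left, pairing_zero_right, pairing_neg_right, pairing_swap,
      pairing_neg_right, pairing_swap] at h
    linarith
  exact key k (G.mul_unit k)

theorem mem_commonKer {P : G.PolyVector 2} (hP : P.IsMultiplicative) (m : G.M)
    (α : Module.Dual ℝ (G.TM m)) :
    α ∈ P.commonKer m ↔ (∀ v : G.TΓ (G.unit m), α (G.TtUnit m v) = α (G.TsUnit m v)) ∧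
      ∀ η, P (G.unit m) ![η, sPull (G.unit m) α] = 0 := by
  have h1 : (G.anchor m).dualMap α = 0 ↔
      ∀ v : G.TΓ (G.unit m), α (G.TtUnit m v) = α (G.TsUnit m v) := by
    constructor
    · intro h v
      have := congrArg (fun φ : Module.Dual ℝ (G.A m) => φ (G.projA m v)) h
      have e : G.TtUnit m (G.projA m v : G.TΓ (G.unit m)) = G.TtUnit m v - G.TsUnit m v := by
        change G.TtUnit m (v - G.Tunit m (G.TsUnit m v)) = _
        rw [map_sub, TtUnit_Tunit]
      change α (G.TtUnit m (G.projA m v : G.TΓ (G.unit m))) = 0 at this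
      rw [e, map_sub] at this
      linarith
    · intro h
      ext a
      have := h a
      have ha : G.TsUnit m (a : G.TΓ (G.unit m)) = 0 := a.2
      rw [ha, map_zero] at this
      exact this
  have h2 : P.rhoStarDual m α = 0 ↔
      ∀ ξ : Module.Dual ℝ (G.A m), P (G.unit m) ![ξ ∘ₗ G.projA m, sPull (G.unit m) α] = 0 := by
    have e : ∀ ξ : Module.Dual ℝ (G.A m),
        P (G.unit m) ![ξ ∘ₗ G.projA m, sPull (G.unit m) α] = ξ (P.rhoStarDual m α) := by
      intro ξ
      rw [P.apply_rhoStarDual, ← P.apply_sharp]; rfl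
    simp only [e]
    exact ⟨fun h ξ => by rw [h, map_zero], fun h => (Module.forall_dual_apply_eq_zero_iff ℝ _).1 h⟩
  rw [PolyVector.commonKer, Submodule.mem_inf, LinearMap.mem_ker, LinearMap.mem_ker, h1, h2]
  refine and_congr_right fun hα => ⟨fun h η => ?_, fun h ξ => h _⟩
  have hst : sPull (G.unit m) α = tPull (G.unit m) α := by
    ext v; exact (hα v).symm
  have hη : η = (η ∘ₗ (G.A m).subtype) ∘ₗ G.projA m + sPull (G.unit m) (η ∘ₗ G.Tunit m) := by
    ext v
    change η v = η (v - G.Tunit m (G.TsUnit m v)) + η (G.Tunit m (G.TsUnit m v))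
    rw [map_sub]; ring
  have h3 : P (G.unit m) ![tPull (G.unit m) α, sPull (G.unit m) (η ∘ₗ G.Tunit m)] = 0 :=
    pairing_t_s hP (G.unit m) α (η ∘ₗ G.Tunit m)
  rw [hη, pairing_add_left, h, hst, pairing_swap, h3, neg_zero, add_zero]

theorem finrank_commonKer_le {P : G.PolyVector 2} (hP : P.IsMultiplicative) (γ : G.Γ) :
    Module.finrank ℝ (P.commonKer (G.s γ)) ≤ Module.finrank ℝ (P.commonKer (G.t γ)) := by
  have inj_s : Function.Injective (G.Ts γ).dualMap :=
    LinearMap.dualMap_injective_of_surjective (G.submersion_s γ)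
  have inj_t : Function.Injective (G.Tt γ).dualMap :=
    LinearMap.dualMap_injective_of_surjective (G.submersion_t γ)
  have hle : (P.commonKer (G.s γ)).map (G.Ts γ).dualMap ≤
      (P.commonKer (G.t γ)).map (G.Tt γ).dualMap := by
    rintro _ ⟨α, hα, rfl⟩
    obtain ⟨hα1, hα2⟩ := (mem_commonKer hP _ α).1 hα
    have h1 : ∀ η, P γ ![η, sPull γ α] = 0 := by
      have key : ∀ k, G.mul γ (G.unit (G.s γ)) = k → ∀ η, P k ![η, sPull k α] = 0 := by
        rintro _ rfl η
        have h := hP.two (G.t_unit _).symm (isConormal_of_last γ (G.unit (G.s γ)) η)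
          (isConormal_s (g := γ) (G.t_unit _).symm α)
        rw [pairing_zero_right, hα2, pairing_neg_right] at h
        linarith
      exact key γ (G.mul_unit γ)
    have h2 : ∀ u : G.TΓ γ, G.Tt γ u = 0 → α (G.Ts γ u) = 0 := by
      intro u hu
      have hc : G.TComposable (G.inv γ) γ 0 u := by
        change (G.Ts (G.inv γ) 0 : EuclideanSpace ℝ (Fin G.dimM)) = G.Tt γ u
        rw [hu, map_zero]; rfl
      have key : ∀ k, G.unit (G.s γ) = k → ∀ v : G.TΓ k,
          (show Module.Dual ℝ (EuclideanSpace ℝ (Fin G.dimM)) from α) (G.Tt k v) =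
          (show Module.Dual ℝ (EuclideanSpace ℝ (Fin G.dimM)) from α) (G.Ts k v) := by
        rintro _ rfl v; exact hα1 v
      have h := key _ (G.inv_mul γ).symm (G.Tmul (G.inv γ) γ (0, u))
      rw [Ts_Tmul (G.s_inv γ) hc, Tt_Tmul (G.s_inv γ) hc] at h
      have z : (show Module.Dual ℝ (EuclideanSpace ℝ (Fin G.dimM)) from α)
        (G.Tt (G.inv γ) 0) = 0 := by rw [map_zero]; exact map_zero α
      rw [z] at h
      exact h.symm
    obtain ⟨β, hβ⟩ : ∃ β : Module.Dual ℝ (G.TM (G.t γ)), (G.Tt γ).dualMap β = (G.Ts γ).dualMap α := by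
      have : (G.Ts γ).dualMap α ∈ LinearMap.range (G.Tt γ).dualMap := by
        rw [LinearMap.range_dualMap_eq_dualAnnihilator_ker, Submodule.mem_dualAnnihilator]
        exact fun u hu => h2 u hu
      exact this
    have hfirst : ∀ w : G.TΓ (G.unit (G.t γ)),
        β (G.TtUnit (G.t γ) w) = β (G.TsUnit (G.t γ) w) := by
      intro w
      obtain ⟨v, hv⟩ := G.submersion_t γ (G.TsUnit (G.t γ) w)
      have hc : G.TComposable (G.unit (G.t γ)) γ w v := hv.symm
      have key : ∀ k, γ = k → ∀ x : G.TΓ k,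
          (show Module.Dual ℝ (EuclideanSpace ℝ (Fin G.dimM)) from β) (G.Tt k x) =
          (show Module.Dual ℝ (EuclideanSpace ℝ (Fin G.dimM)) from α) (G.Ts k x) := by
        rintro _ rfl x
        exact congrArg (fun φ : Module.Dual ℝ (G.TΓ γ) => φ x) hβ
      have h := key _ (G.unit_mul γ).symm (G.Tmul (G.unit (G.t γ)) γ (w, v))
      rw [Ts_Tmul (G.s_unit _) hc, Tt_Tmul (G.s_unit _) hc, ← key γ rfl v] at h
      exact h.trans (congrArg β hv)
    refine ⟨β, (mem_commonKer hP _ β).2 ⟨hfirst, fun η => ?_⟩, hβ⟩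
    · have hγ : ∀ η, P γ ![η, tPull γ β] = 0 := by
        intro η
        have : tPull γ β = sPull γ α := hβ
        rw [this]; exact h1 η
      have key : ∀ k, G.mul γ (G.inv γ) = k → ∀ η, P k ![η, tPull k β] = 0 := by
        rintro _ rfl η
        have h := hP.two (G.t_inv γ).symm (isConormal_of_last γ (G.inv γ) η)
          (isConormal_t (h := G.inv γ) (G.t_inv γ).symm β)
        rw [pairing_zero_right, hγ, pairing_neg_right] at h
        linarith
      have hst : sPull (G.unit (G.t γ)) β = tPull (G.unit (G.t γ)) β := by
        ext v; exact (hfirst v).symm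
      rw [hst]
      exact key _ (G.mul_inv γ) η
  have e1 := (Submodule.equivMapOfInjective _ inj_s (P.commonKer (G.s γ))).finrank_eq
  have e2 := (Submodule.equivMapOfInjective _ inj_t (P.commonKer (G.t γ))).finrank_eq
  rw [e1, e2]
  exact Submodule.finrank_mono hle

theorem finrank_commonKer_orbit {P : G.PolyVector 2} (hP : P.IsMultiplicative) {m n : G.M}
    (h : G.orbitSetoid.r m n) :
    Module.finrank ℝ (P.commonKer m) = Module.finrank ℝ (P.commonKer n) := by
  obtain ⟨γ, rfl, rfl⟩ := h
  refine le_antisymm (finrank_commonKer_le hP γ) ?_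
  have := finrank_commonKer_le hP (G.inv γ)
  rwa [G.s_inv, G.t_inv] at this

end

end LieGroupoid

noncomputable section

namespace TwoTerm

variable {V₁ V₀ W₁ W₀ : Type*} [AddCommGroup V₁] [Module ℝ V₁] [AddCommGroup V₀] [Module ℝ V₀]
  [AddCommGroup W₁] [Module ℝ W₁] [AddCommGroup W₀] [Module ℝ W₀]
  {d : V₁ →ₗ[ℝ] V₀} {d' : W₁ →ₗ[ℝ] W₀} {f₁ : V₁ →ₗ[ℝ] W₁} {f₀ : V₀ →ₗ[ℝ] W₀}

/-- The map induced on kernels. -/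
def kerMap (comm : d' ∘ₗ f₁ = f₀ ∘ₗ d) : LinearMap.ker d →ₗ[ℝ] LinearMap.ker d' :=
  f₁.restrict fun x hx => by
    have := LinearMap.congr_fun comm x
    simpa [LinearMap.mem_ker.1 hx] using this

/-- The map induced on cokernels. -/
def cokerMap (comm : d' ∘ₗ f₁ = f₀ ∘ₗ d) :
    (V₀ ⧸ LinearMap.range d) →ₗ[ℝ] (W₀ ⧸ LinearMap.range d') :=
  Submodule.mapQ _ _ f₀ <| by
    rintro _ ⟨x, rfl⟩
    exact ⟨f₁ x, LinearMap.congr_fun comm x⟩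

/-- `(f₁, f₀)` is a quasi-isomorphism from the 2-term complex `d : V₁ → V₀` to `d' : W₁ → W₀`: a
chain map that induces isomorphisms on kernels and on cokernels. -/
def IsQuasiIso (d : V₁ →ₗ[ℝ] V₀) (d' : W₁ →ₗ[ℝ] W₀) (f₁ : V₁ →ₗ[ℝ] W₁) (f₀ : V₀ →ₗ[ℝ] W₀) :
    Prop :=
  ∃ comm : d' ∘ₗ f₁ = f₀ ∘ₗ d,
    Function.Bijective (kerMap comm) ∧ Function.Bijective (cokerMap comm)

end TwoTerm

namespace LieGroupoid

/-- Morita morphisms of Lie groupoids: a morphism of Lie groupoids over a surjective submersion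
`onM` which identifies the source `G` with the pull-back groupoid, that is, the map
`g ↦ (t g, onΓ g, s g)` is a diffeomorphism onto the fibre product of `M_G`, `Γ_H`, `M_G` over
`M_H`, `M_H`. It is required to be bijective with bijective differentials. -/
structure MoritaMorphism (G H : LieGroupoid.{u}) where
  onM : G.M → H.M
  onΓ : G.Γ → H.Γ
  smooth_onM : ContMDiff (𝓡 G.dimM) (𝓡 H.dimM) ∞ onM
  smooth_onΓ : ContMDiff (𝓡 G.dimΓ) (𝓡 H.dimΓ) ∞ onΓ
  map_s : ∀ g, H.s (onΓ g) = onM (G.s g)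
  map_t : ∀ g, H.t (onΓ g) = onM (G.t g)
  map_unit : ∀ m, onΓ (G.unit m) = H.unit (onM m)
  map_mul : ∀ g h, G.s g = G.t h → onΓ (G.mul g h) = H.mul (onΓ g) (onΓ h)
  surjective : Function.Surjective onM
  submersion : ∀ m, Function.Surjective (mfderiv (𝓡 G.dimM) (𝓡 H.dimM) onM m)
  cartesian : ∀ (x y : G.M) (γ : H.Γ), onM x = H.t γ → onM y = H.s γ →
    ∃! g : G.Γ, G.t g = x ∧ G.s g = y ∧ onΓ g = γ
  cartesian_tangent : ∀ (g : G.Γ) (ξ : G.TM (G.t g)) (η : G.TM (G.s g)) (v : H.TΓ (onΓ g)),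
    (mfderiv (𝓡 G.dimM) (𝓡 H.dimM) onM (G.t g) ξ : EuclideanSpace ℝ (Fin H.dimM)) =
        H.Tt (onΓ g) v →
    (mfderiv (𝓡 G.dimM) (𝓡 H.dimM) onM (G.s g) η : EuclideanSpace ℝ (Fin H.dimM)) =
        H.Ts (onΓ g) v →
    ∃! w : G.TΓ g, G.Tt g w = ξ ∧ G.Ts g w = η ∧
      mfderiv (𝓡 G.dimΓ) (𝓡 H.dimΓ) onΓ g w = v

namespace MoritaMorphism

variable {G H : LieGroupoid.{u}} (φ : MoritaMorphism G H)

def TonM (m : G.M) : G.TM m →ₗ[ℝ] H.TM (φ.onM m) :=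
  (mfderiv (𝓡 G.dimM) (𝓡 H.dimM) φ.onM m).toLinearMap

def TonΓ (g : G.Γ) : G.TΓ g →ₗ[ℝ] H.TΓ (φ.onΓ g) :=
  (mfderiv (𝓡 G.dimΓ) (𝓡 H.dimΓ) φ.onΓ g).toLinearMap

/-- `TonΓ` at a unit. -/
def TonΓUnit (m : G.M) : G.TΓ (G.unit m) →ₗ[ℝ] H.TΓ (H.unit (φ.onM m)) := φ.TonΓ (G.unit m)

theorem map_Ts (g : G.Γ) (w : G.TΓ g) :
    (H.Ts (φ.onΓ g) (φ.TonΓ g w) : EuclideanSpace ℝ (Fin H.dimM)) = φ.TonM (G.s g) (G.Ts g w) := by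
  have h₁ := HasMFDerivAt.comp g ((H.smooth_s.mdifferentiable (by simp)) (φ.onΓ g)).hasMFDerivAt
    ((φ.smooth_onΓ.mdifferentiable (by simp)) g).hasMFDerivAt
  have h₂ := HasMFDerivAt.comp g ((φ.smooth_onM.mdifferentiable (by simp)) (G.s g)).hasMFDerivAt
    ((G.smooth_s.mdifferentiable (by simp)) g).hasMFDerivAt
  have e : H.s ∘ φ.onΓ = φ.onM ∘ G.s := funext φ.map_s
  rw [e] at h₁
  exact congrArg (fun L : EuclideanSpace ℝ (Fin G.dimΓ) →L[ℝ] EuclideanSpace ℝ (Fin H.dimM) => L w)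
    (hasMFDerivAt_unique h₁ h₂)

theorem map_Tt (g : G.Γ) (w : G.TΓ g) :
    (H.Tt (φ.onΓ g) (φ.TonΓ g w) : EuclideanSpace ℝ (Fin H.dimM)) = φ.TonM (G.t g) (G.Tt g w) := by
  have h₁ := HasMFDerivAt.comp g ((H.smooth_t.mdifferentiable (by simp)) (φ.onΓ g)).hasMFDerivAt
    ((φ.smooth_onΓ.mdifferentiable (by simp)) g).hasMFDerivAt
  have h₂ := HasMFDerivAt.comp g ((φ.smooth_onM.mdifferentiable (by simp)) (G.t g)).hasMFDerivAt
    ((G.smooth_t.mdifferentiable (by simp)) g).hasMFDerivAt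
  have e : H.t ∘ φ.onΓ = φ.onM ∘ G.t := funext φ.map_t
  rw [e] at h₁
  exact congrArg (fun L : EuclideanSpace ℝ (Fin G.dimΓ) →L[ℝ] EuclideanSpace ℝ (Fin H.dimM) => L w)
    (hasMFDerivAt_unique h₁ h₂)

theorem dim_eq (φ : MoritaMorphism G H) : G.dim = H.dim := by
  obtain ⟨m⟩ : Nonempty G.M := inferInstance
  let g := G.unit m
  let EM := EuclideanSpace ℝ (Fin G.dimM)
  let EΓ := EuclideanSpace ℝ (Fin G.dimΓ)
  let FM := EuclideanSpace ℝ (Fin H.dimM)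
  let FΓ := EuclideanSpace ℝ (Fin H.dimΓ)
  let a : EM →ₗ[ℝ] FM := φ.TonM (G.t g)
  let b : EM →ₗ[ℝ] FM := φ.TonM (G.s g)
  let tt : FΓ →ₗ[ℝ] FM := H.Tt (φ.onΓ g)
  let ss : FΓ →ₗ[ℝ] FM := H.Ts (φ.onΓ g)
  let θ : EΓ →ₗ[ℝ] EM × EM × FΓ :=
    LinearMap.prod (G.Tt g) (LinearMap.prod (G.Ts g) (φ.TonΓ g))
  let κ : (EM × EM × FΓ) →ₗ[ℝ] FM × FM :=
    LinearMap.prod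
      (a ∘ₗ LinearMap.fst ℝ _ _ - tt ∘ₗ LinearMap.snd ℝ _ _ ∘ₗ LinearMap.snd ℝ _ _)
      (b ∘ₗ LinearMap.fst ℝ _ _ ∘ₗ LinearMap.snd ℝ _ _
        - ss ∘ₗ LinearMap.snd ℝ _ _ ∘ₗ LinearMap.snd ℝ _ _)
  have hκ : Function.Surjective κ := by
    rintro ⟨p, q⟩
    obtain ⟨x, hx⟩ := φ.submersion (G.t g) p
    obtain ⟨y, hy⟩ := φ.submersion (G.s g) q
    refine ⟨((x : EM), (y : EM), (0 : FΓ)), ?_⟩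
    have h1 : a x - tt 0 = p := by rw [map_zero, sub_zero]; exact hx
    have h2 : b y - ss 0 = q := by rw [map_zero, sub_zero]; exact hy
    exact Prod.ext h1 h2
  have hker : LinearMap.range θ = LinearMap.ker κ := by
    ext ⟨x, y, v⟩
    constructor
    · rintro ⟨w, hw⟩
      have h1 : G.Tt g w = x := congrArg Prod.fst hw
      have h2 : G.Ts g w = y := congrArg (fun z => z.2.1) hw
      have h3 : φ.TonΓ g w = v := congrArg (fun z => z.2.2) hw
      have e1 : a x - tt v = 0 := by
        rw [← h1, ← h3]; exact sub_eq_zero.2 (φ.map_Tt g w).symm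
      have e2 : b y - ss v = 0 := by
        rw [← h2, ← h3]; exact sub_eq_zero.2 (φ.map_Ts g w).symm
      exact Prod.ext e1 e2
    · intro h
      have e1 : a x - tt v = 0 := congrArg Prod.fst h
      have e2 : b y - ss v = 0 := congrArg Prod.snd h
      obtain ⟨w, ⟨h1, h2, h3⟩, -⟩ :=
        φ.cartesian_tangent g x y v (sub_eq_zero.1 e1) (sub_eq_zero.1 e2)
      exact ⟨w, Prod.ext h1 (Prod.ext h2 h3)⟩
  have hinj : Function.Injective θ := by
    rw [← LinearMap.ker_eq_bot, LinearMap.ker_eq_bot']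
    intro w hw
    have h1 : G.Tt g w = 0 := congrArg Prod.fst hw
    have h2 : G.Ts g w = 0 := congrArg (fun z => z.2.1) hw
    have h3 : φ.TonΓ g w = 0 := congrArg (fun z => z.2.2) hw
    have z1 : a 0 = tt 0 := by rw [map_zero, map_zero]
    have z2 : b 0 = ss 0 := by rw [map_zero, map_zero]
    obtain ⟨w', -, hu⟩ := φ.cartesian_tangent g 0 0 0 z1 z2
    exact (hu w ⟨h1, h2, h3⟩).trans
      (hu 0 ⟨map_zero (G.Tt g), map_zero (G.Ts g), map_zero (φ.TonΓ g)⟩).symm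
  have r1 := LinearMap.finrank_range_add_finrank_ker κ
  rw [LinearMap.range_eq_top.2 hκ, ← hker, LinearMap.finrank_range_of_inj hinj, finrank_top] at r1
  simp only [Module.finrank_prod, EM, EΓ, FM, FΓ, finrank_euclideanSpace, Fintype.card_fin] at r1
  simp only [LieGroupoid.dim, LieGroupoid.rkA]
  omega

end MoritaMorphism

namespace QuasiPoissonStructure

variable {G : LieGroupoid.{u}} (S : G.QuasiPoissonStructure)

/-- Non-degeneracy: at each point the chain map `(-ρ_*^∨, ρ_*)` from `ρ^∨ : T^∨ M → A^∨` to
`ρ : A → TM` is a quasi-isomorphism. -/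
def IsNondegenerate : Prop :=
  ∀ m : G.M, TwoTerm.IsQuasiIso (G.anchor m).dualMap (G.anchor m)
    (-S.Pi.rhoStarDual m) (S.Pi.rhoStar m)

/-- The rank, as a function on the coarse moduli space: `dim 𝔛 - dim (ker ρ^∨ ∩ ker ρ_*^∨)`. -/
def rank (x : G.CoarseModuli) : ℤ :=
  G.dim - Quotient.lift (s := G.orbitSetoid)
    (fun m => (Module.finrank ℝ (S.Pi.commonKer m) : ℤ))
    (fun _ _ h => congrArg _ (finrank_commonKer_orbit S.multiplicative h)) x

end QuasiPoissonStructure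

end LieGroupoid

/-- Quasi-Poisson groupoids. -/
structure QuasiPoissonGroupoid where
  groupoid : LieGroupoid.{u}
  poisson : groupoid.QuasiPoissonStructure

namespace QuasiPoissonGroupoid

open LieGroupoid

/-- `φ_* Π = Π'` and `φ_* Λ = Λ'`; the latter is tested on covectors of `A` that are restrictions
of covectors at units. -/
def Projects {G H : LieGroupoid.{u}} (φ : MoritaMorphism G H) (S : G.QuasiPoissonStructure)
    (S' : H.QuasiPoissonStructure) : Prop :=
  (∀ (g : G.Γ) (ξ : Fin 2 → Module.Dual ℝ (H.TΓ (φ.onΓ g))),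
    S.Pi g (fun i => ξ i ∘ₗ φ.TonΓ g) = S'.Pi (φ.onΓ g) ξ) ∧
  ∀ (m : G.M) (ξ : Fin 3 → Module.Dual ℝ (H.TΓ (H.unit (φ.onM m)))),
    S.Lam m (fun i => (ξ i ∘ₗ φ.TonΓUnit m) ∘ₗ (G.A m).subtype) =
      S'.Lam (φ.onM m) (fun i => ξ i ∘ₗ (H.A (φ.onM m)).subtype)

/-- Morita morphisms of quasi-Poisson groupoids: Morita morphisms `φ` of Lie groupoids such that
some twist of the structure of `X` is projectable, with image the structure of `Y`. -/
def IsMoritaMorphism (X Y : QuasiPoissonGroupoid.{u})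
    (φ : MoritaMorphism X.groupoid Y.groupoid) : Prop :=
  ∃ (T : X.groupoid.ASection 2) (S : X.groupoid.QuasiPoissonStructure),
    T.IsSmooth ∧ IsTwist T X.poisson S ∧ Projects φ S Y.poisson

/-- Morita equivalence of quasi-Poisson groupoids. -/
def MoritaEquivalent (X Y : QuasiPoissonGroupoid.{u}) : Prop :=
  ∃ (Z : QuasiPoissonGroupoid.{u}) (φ : MoritaMorphism Z.groupoid X.groupoid)
    (ψ : MoritaMorphism Z.groupoid Y.groupoid), Z.IsMoritaMorphism X φ ∧ Z.IsMoritaMorphism Y ψ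

end QuasiPoissonGroupoid

/-- `(+1)`-shifted Poisson differentiable stacks, up to isomorphism: Morita equivalence classes of
quasi-Poisson groupoids. -/
def ShiftedPoissonStack : Type (u + 1) := Quot QuasiPoissonGroupoid.MoritaEquivalent.{u}

namespace ShiftedPoissonStack

/-- `X` belongs to the Morita equivalence class `𝔛`. -/
def IsPresentedBy (𝔛 : ShiftedPoissonStack.{u}) (X : QuasiPoissonGroupoid.{u}) : Prop :=
  Quot.mk _ X = 𝔛

/-- The dimension `dim M - rk A` of any presentation. -/
def dim (𝔛 : ShiftedPoissonStack.{u}) : ℤ :=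
  Quot.lift (fun X : QuasiPoissonGroupoid.{u} => X.groupoid.dim)
    (by
      rintro X Y ⟨Z, φ, ψ, -, -⟩
      exact φ.dim_eq.symm.trans ψ.dim_eq) 𝔛

/-- Non-degeneracy, required of every presentation. -/
def IsNondegenerate (𝔛 : ShiftedPoissonStack.{u}) : Prop :=
  ∀ X : QuasiPoissonGroupoid.{u}, 𝔛.IsPresentedBy X → X.poisson.IsNondegenerate

end ShiftedPoissonStack

end

/-!
Everything is reduced to the space `K_m = ker ρ^∨ ∩ ker ρ_*^∨` (`PolyVector.commonKer`) at the
points `m` of the base of a presentation.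

The complex `ρ^∨ : T^∨ M → A^∨` is the dual of `ρ : A → TM`, and `ρ_*^∨` is the transpose of `ρ_*`.
Hence the map that the chain map `(-ρ_*^∨, ρ_*)` induces on cokernels is, up to sign, the transpose
of the map it induces on kernels. The latter has kernel `K_m`, and goes from a space of dimension
`dim M - rank ρ` to one of dimension `rk A - rank ρ`. So the chain map is a quasi-isomorphism at
`m` if and only if `dim M = rk A` and `K_m = 0` (`TwoTerm.isQuasiIso_dualMap_iff`,
`QuasiPoissonStructure.isNondegenerate_iff`). That it is a chain map at all follows from the
multiplicativity of `Π`, through `Π(t^* α, s^* β) = 0`.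

It remains to see that the vanishing of `K` does not depend on the presentation. By `mem_commonKer`,
a covector `α` is in `K_m` when `t^* α = s^* α` at the unit and `Π^# s^* α = 0`.
* A twist adds a right-invariant minus a left-invariant field. Right-invariant vectors are killed
  by `s_*` and left-invariant ones by `t_*`, so for `s^* α = t^* α` neither changes `Π^# s^* α`
  (`IsTwist.commonKer_eq`).
* If a bivector field projects along a Morita morphism over `f : M₁ → M₂`, the transpose of `f_*`
  maps `K_{f(m)}` onto `K_m`, injectively since `f` is a submersion. The tangent space of the
  pull-back groupoid being a fibre product, `Π^# s^* f^* α` vanishes because its images under `s_*`,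
  `t_*` and the projection do; and a covector with `t^* β = s^* β` kills `ker f_*`
  (`Projects.map_commonKer`).

Since `f` is onto, Morita morphisms preserve and reflect non-degeneracy.
-/

/-! ### Quasi-isomorphisms of two-term complexes -/

namespace TwoTerm

section

variable {V₁ V₀ W₁ W₀ : Type*} [AddCommGroup V₁] [Module ℝ V₁] [AddCommGroup V₀] [Module ℝ V₀]
  [AddCommGroup W₁] [Module ℝ W₁] [AddCommGroup W₀] [Module ℝ W₀]
  {d : V₁ →ₗ[ℝ] V₀} {d' : W₁ →ₗ[ℝ] W₀} {f₁ : V₁ →ₗ[ℝ] W₁} {f₀ : V₀ →ₗ[ℝ] W₀}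

theorem injective_kerMap_iff (comm : d' ∘ₗ f₁ = f₀ ∘ₗ d) :
    Function.Injective (kerMap comm) ↔ LinearMap.ker d ⊓ LinearMap.ker f₁ = ⊥ := by
  rw [← LinearMap.ker_eq_bot, LinearMap.ker_eq_bot', Submodule.eq_bot_iff]
  constructor
  · rintro h x ⟨h₁, h₂⟩
    exact congrArg Subtype.val (h ⟨x, h₁⟩ (Subtype.ext h₂))
  · rintro h ⟨x, h₁⟩ h₂
    exact Subtype.ext (h x ⟨h₁, congrArg Subtype.val h₂⟩)

theorem surjective_cokerMap_iff (comm : d' ∘ₗ f₁ = f₀ ∘ₗ d) :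
    Function.Surjective (cokerMap comm) ↔ LinearMap.range d' ⊔ LinearMap.range f₀ = ⊤ := by
  rw [Submodule.eq_top_iff']
  constructor
  · intro h w
    obtain ⟨y, hy⟩ := h (Submodule.Quotient.mk w)
    obtain ⟨v, rfl⟩ := Submodule.mkQ_surjective _ y
    obtain ⟨x, hx⟩ := (Submodule.Quotient.eq _).1 hy.symm
    exact Submodule.mem_sup.2 ⟨_, ⟨x, rfl⟩, _, ⟨v, rfl⟩, by rw [hx, sub_add_cancel]⟩
  · intro h y
    obtain ⟨w, rfl⟩ := Submodule.mkQ_surjective _ y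
    obtain ⟨_, ⟨x, rfl⟩, _, ⟨v, rfl⟩, rfl⟩ := Submodule.mem_sup.1 (h w)
    refine ⟨Submodule.Quotient.mk v, ?_⟩
    change Submodule.Quotient.mk (f₀ v) = Submodule.Quotient.mk (d' x + f₀ v)
    rw [Submodule.Quotient.eq]
    exact ⟨-x, by rw [map_neg]; abel⟩

theorem isQuasiIso_iff [FiniteDimensional ℝ V₁] [FiniteDimensional ℝ V₀] [FiniteDimensional ℝ W₁]
    [FiniteDimensional ℝ W₀] (comm : d' ∘ₗ f₁ = f₀ ∘ₗ d) :
    IsQuasiIso d d' f₁ f₀ ↔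
      (Module.finrank ℝ (LinearMap.ker d) = Module.finrank ℝ (LinearMap.ker d') ∧
        LinearMap.ker d ⊓ LinearMap.ker f₁ = ⊥) ∧
      Module.finrank ℝ (V₀ ⧸ LinearMap.range d) = Module.finrank ℝ (W₀ ⧸ LinearMap.range d') ∧
        LinearMap.range d' ⊔ LinearMap.range f₀ = ⊤ := by
  rw [← injective_kerMap_iff comm, ← surjective_cokerMap_iff comm]
  constructor
  · rintro ⟨_, hk, hc⟩
    exact ⟨⟨(LinearEquiv.ofBijective _ hk).finrank_eq, hk.1⟩,
      (LinearEquiv.ofBijective _ hc).finrank_eq, hc.2⟩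
  · rintro ⟨⟨e₁, hk⟩, e₀, hc⟩
    exact ⟨comm, ⟨hk, (LinearMap.injective_iff_surjective_of_finrank_eq_finrank e₁).1 hk⟩,
      (LinearMap.injective_iff_surjective_of_finrank_eq_finrank e₀).2 hc, hc⟩

end

variable {V W : Type*} [AddCommGroup V] [Module ℝ V] [FiniteDimensional ℝ V]
  [AddCommGroup W] [Module ℝ W] [FiniteDimensional ℝ W]

/-- A chain map from the dual of `D : W → V` to `D` whose components `-R'`, `R` are transposes of
each other up to sign. The map on cokernels is, up to sign, the transpose of the map on kernels, so
the latter decides; its kernel is `ker D.dualMap ⊓ ker R'`. -/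
theorem isQuasiIso_dualMap_iff {D : W →ₗ[ℝ] V} {R : Module.Dual ℝ W →ₗ[ℝ] V}
    {R' : Module.Dual ℝ V →ₗ[ℝ] W}
    (hR : ∀ (α : Module.Dual ℝ V) (ξ : Module.Dual ℝ W), ξ (R' α) = α (R ξ))
    (comm : D ∘ₗ (-R') = R ∘ₗ D.dualMap) :
    IsQuasiIso D.dualMap D (-R') R ↔
      Module.finrank ℝ V = Module.finrank ℝ W ∧
        LinearMap.ker D.dualMap ⊓ LinearMap.ker R' = ⊥ := by
  have hker : Module.finrank ℝ (LinearMap.range D) +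
      Module.finrank ℝ (LinearMap.ker D.dualMap) = Module.finrank ℝ V := by
    rw [← LinearMap.finrank_range_dualMap_eq_finrank_range,
      LinearMap.finrank_range_add_finrank_ker, Subspace.dual_finrank_eq]
  have hker' := LinearMap.finrank_range_add_finrank_ker D
  have hcok := Submodule.finrank_quotient_add_finrank (LinearMap.range D.dualMap)
  have hcok' := Submodule.finrank_quotient_add_finrank (LinearMap.range D)
  rw [LinearMap.finrank_range_dualMap_eq_finrank_range, Subspace.dual_finrank_eq] at hcok
  have hneg : LinearMap.ker (-R') = LinearMap.ker R' := by
    ext α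
    simp
  refine (isQuasiIso_iff comm).trans ?_
  rw [hneg]
  constructor
  · rintro ⟨⟨h, hc⟩, -⟩
    exact ⟨by omega, hc⟩
  · rintro ⟨h, hc⟩
    refine ⟨⟨by omega, hc⟩, by omega, ?_⟩
    -- A covector that kills `range D` and `range R` lies in `ker D.dualMap ⊓ ker R'`.
    rw [← Subspace.dualAnnihilator_inj, Submodule.dualAnnihilator_top,
      Submodule.dualAnnihilator_sup_eq, Submodule.eq_bot_iff]
    rintro α ⟨h₁, h₂⟩
    rw [SetLike.mem_coe, Submodule.mem_dualAnnihilator] at h₁ h₂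
    rw [Submodule.eq_bot_iff] at hc
    refine hc α ⟨?_, ?_⟩
    · ext w
      exact h₁ _ ⟨w, rfl⟩
    · rw [SetLike.mem_coe, LinearMap.mem_ker, ← Module.forall_dual_apply_eq_zero_iff ℝ]
      exact fun ξ => (hR α ξ).trans (h₂ _ ⟨ξ, rfl⟩)

end TwoTerm

/-! ### Non-degeneracy and the common kernel -/

namespace LieGroupoid

variable {G H : LieGroupoid.{u}}

theorem finrank_A (m : G.M) : (Module.finrank ℝ (G.A m) : ℤ) = G.rkA := by
  have h := LinearMap.finrank_range_add_finrank_ker (G.TsUnit m)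
  have hs : LinearMap.range (G.TsUnit m) = ⊤ :=
    LinearMap.range_eq_top.2 (G.submersion_s (G.unit m))
  have h₁ : Module.finrank ℝ (G.TM m) = G.dimM := finrank_euclideanSpace_fin
  have h₂ : Module.finrank ℝ (G.TΓ (G.unit m)) = G.dimΓ := finrank_euclideanSpace_fin
  rw [hs, finrank_top, h₁, h₂] at h
  change (Module.finrank ℝ (LinearMap.ker (G.TsUnit m)) : ℤ) = _
  rw [rkA]
  omega

/-- The covector `ρ^∨ α`, extended by zero on `T_m M`, is `t^* α - s^* α`, and `Π` pairs pull-backs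
along `t` with pull-backs along `s` to zero. -/
theorem apply_rhoStar_dualMap_anchor {P : G.PolyVector 2} (hP : P.IsMultiplicative) (m : G.M)
    (α β : Module.Dual ℝ (G.TM m)) :
    β (P.rhoStar m ((G.anchor m).dualMap α)) =
      -P (G.unit m) ![sPull (G.unit m) α, sPull (G.unit m) β] := by
  have e : (G.anchor m).dualMap α ∘ₗ G.projA m + sPull (G.unit m) α = tPull (G.unit m) α := by
    ext v
    change α (G.TtUnit m (v - G.Tunit m (G.TsUnit m v))) + α (G.TsUnit m v) = α (G.TtUnit m v)
    rw [map_sub, TtUnit_Tunit, map_sub, sub_add_cancel]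
  have h : P (G.unit m) ![tPull (G.unit m) α, sPull (G.unit m) β] = 0 :=
    pairing_t_s hP (G.unit m) α β
  rw [← e, pairing_add_left, ← P.apply_sharp] at h
  exact eq_neg_of_add_eq_zero_left h

/-- `(-ρ_*^∨, ρ_*)` is a chain map: both composites pair with covectors as `Π` does with the
pull-backs along `s`, up to sign. -/
theorem anchor_comp_neg_rhoStarDual {P : G.PolyVector 2} (hP : P.IsMultiplicative) (m : G.M) :
    G.anchor m ∘ₗ (-P.rhoStarDual m) = P.rhoStar m ∘ₗ (G.anchor m).dualMap := by
  ext1 α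
  rw [← sub_eq_zero, ← Module.forall_dual_apply_eq_zero_iff ℝ]
  intro β
  have h₁ : β (G.anchor m (P.rhoStarDual m α)) = α (P.rhoStar m ((G.anchor m).dualMap β)) :=
    P.apply_rhoStarDual m α ((G.anchor m).dualMap β)
  rw [LinearMap.comp_apply, LinearMap.comp_apply, LinearMap.neg_apply, map_neg, map_sub, map_neg,
    h₁, apply_rhoStar_dualMap_anchor hP, apply_rhoStar_dualMap_anchor hP, pairing_swap]
  ring

theorem QuasiPoissonStructure.isNondegenerate_iff (S : G.QuasiPoissonStructure) :
    S.IsNondegenerate ↔ G.dim = 0 ∧ ∀ m, Module.finrank ℝ (S.Pi.commonKer m) = 0 := by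
  have key : ∀ m, TwoTerm.IsQuasiIso (G.anchor m).dualMap (G.anchor m)
      (-S.Pi.rhoStarDual m) (S.Pi.rhoStar m) ↔
        G.dim = 0 ∧ Module.finrank ℝ (S.Pi.commonKer m) = 0 := by
    intro m
    rw [TwoTerm.isQuasiIso_dualMap_iff (S.Pi.apply_rhoStarDual m)
      (anchor_comp_neg_rhoStarDual S.multiplicative m), Submodule.finrank_eq_zero]
    refine and_congr ?_ Iff.rfl
    have h₁ : Module.finrank ℝ (G.TM m) = G.dimM := finrank_euclideanSpace_fin
    have h₂ := finrank_A m
    rw [h₁, dim]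
    omega
  refine ⟨fun h => ⟨?_, fun m => ((key m).1 (h m)).2⟩, fun h m => (key m).2 ⟨h.1, h.2 m⟩⟩
  obtain ⟨m⟩ : Nonempty G.M := inferInstance
  exact ((key m).1 (h m)).1

/-- The rank is `dim - finrank commonKer`, so its vanishing detects the common kernel only once the
dimension is known to vanish. -/
theorem QuasiPoissonStructure.forall_rank_eq_zero_iff (S : G.QuasiPoissonStructure)
    (hG : G.dim = 0) :
    (∀ x, S.rank x = 0) ↔ ∀ m, Module.finrank ℝ (S.Pi.commonKer m) = 0 := by
  have key : ∀ m : G.M, S.rank (Quotient.mk G.orbitSetoid m) =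
      G.dim - (Module.finrank ℝ (S.Pi.commonKer m) : ℤ) := fun _ => rfl
  constructor
  · intro h m
    have := h (Quotient.mk G.orbitSetoid m)
    rw [key] at this
    omega
  · intro h x
    induction x using Quotient.inductionOn with
    | h m => rw [key, hG, h m]; rfl

/-! ### Invariance under twists -/

theorem Ts_rightTranslation (g : G.Γ) (c : G.A (G.t g)) :
    (G.Ts g (G.rightTranslation g c) : EuclideanSpace ℝ (Fin G.dimM)) = 0 := by
  have hc : G.TComposable (G.unit (G.t g)) g c 0 := by
    have h₁ : G.TsUnit (G.t g) c = 0 := c.2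
    exact h₁.trans (map_zero (G.Tt g)).symm
  have key : ∀ k, k = g → ∀ v : EuclideanSpace ℝ (Fin G.dimΓ),
      (G.Ts k v : EuclideanSpace ℝ (Fin G.dimM)) = G.Ts g v := by
    rintro _ rfl v; rfl
  exact (key _ (G.unit_mul g) _).symm.trans
    ((Ts_Tmul (G.s_unit _) hc).trans (map_zero (G.Ts g)))

theorem Tt_Tinv (g : G.Γ) (v : G.TΓ g) :
    (G.Tt (G.inv g) (G.Tinv g v) : EuclideanSpace ℝ (Fin G.dimM)) = G.Ts g v := by
  have h := HasMFDerivAt.comp g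
    ((G.smooth_t.mdifferentiable (by simp)) (G.inv g)).hasMFDerivAt
    ((G.smooth_inv.mdifferentiable (by simp)) g).hasMFDerivAt
  have e : G.t ∘ G.inv = G.s := funext G.t_inv
  rw [e] at h
  exact congrArg (fun L : EuclideanSpace ℝ (Fin G.dimΓ) →L[ℝ] EuclideanSpace ℝ (Fin G.dimM) => L v)
    (hasMFDerivAt_unique h ((G.smooth_s.mdifferentiable (by simp)) g).hasMFDerivAt)

theorem Tt_leftTranslation (g : G.Γ) (c : G.A (G.s g)) :
    (G.Tt g (G.leftTranslation g c) : EuclideanSpace ℝ (Fin G.dimM)) = 0 := by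
  have hk : G.mul g (G.inv (G.unit (G.s g))) = g := by
    have h := G.mul_inv (G.unit (G.s g))
    have h' := G.unit_mul (G.inv (G.unit (G.s g)))
    rw [G.t_inv, G.s_unit] at h'
    rw [h', G.t_unit] at h
    rw [h, G.mul_unit]
  have hs : G.s g = G.t (G.inv (G.unit (G.s g))) := by rw [G.t_inv, G.s_unit]
  have hc : G.TComposable g (G.inv (G.unit (G.s g))) 0 (G.Tinv (G.unit (G.s g)) c) := by
    have h₁ : G.TsUnit (G.s g) c = 0 := c.2
    exact (map_zero (G.Ts g)).trans (h₁.symm.trans (Tt_Tinv _ _).symm)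
  have key : ∀ k, k = g → ∀ v : EuclideanSpace ℝ (Fin G.dimΓ),
      (G.Tt k v : EuclideanSpace ℝ (Fin G.dimM)) = G.Tt g v := by
    rintro _ rfl v; rfl
  have h := (key _ hk _).symm.trans ((Tt_Tmul hs hc).trans (map_zero (G.Tt g)))
  exact (map_neg (G.Tt g) _).trans (neg_eq_zero.2 h)

/-- A covector in `ker ρ^∨` pulls back in the same way along `s` and `t` at the unit, so it kills
both left- and right-invariant vectors there, and `ρ_*^∨` does not change on it under a twist. -/
theorem IsTwist.commonKer_eq {T : G.ASection 2} {S S' : G.QuasiPoissonStructure}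
    (h : IsTwist T S S') (m : G.M) : S'.Pi.commonKer m = S.Pi.commonKer m := by
  ext α
  rw [mem_commonKer S'.multiplicative, mem_commonKer S.multiplicative]
  refine and_congr_right fun hα => forall_congr' fun η => ?_
  have hr : (G.rightTranslation (G.unit m)).dualMap (sPull (G.unit m) α) = 0 := by
    ext c
    exact (congrArg (fun v : EuclideanSpace ℝ (Fin G.dimM) => α v)
      (Ts_rightTranslation (G.unit m) c)).trans (map_zero α)
  have hl : (G.leftTranslation (G.unit m)).dualMap (sPull (G.unit m) α) = 0 := by
    have hst : sPull (G.unit m) α = tPull (G.unit m) α := by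
      ext v; exact (hα v).symm
    rw [hst]
    ext c
    exact (congrArg (fun v : EuclideanSpace ℝ (Fin G.dimM) => α v)
      (Tt_leftTranslation (G.unit m) c)).trans (map_zero α)
  have hR : T.right (G.unit m) ![η, sPull (G.unit m) α] = 0 :=
    (T (G.t (G.unit m))).map_coord_zero 1 hr
  have hL : T.left (G.unit m) ![η, sPull (G.unit m) α] = 0 :=
    (T (G.s (G.unit m))).map_coord_zero 1 hl
  rw [h.1, AlternatingMap.add_apply, AlternatingMap.sub_apply, hR, hL, sub_zero, add_zero]

/-! ### Invariance under Morita morphisms -/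

namespace MoritaMorphism

variable (φ : MoritaMorphism G H)

theorem TtUnit_TonΓUnit (m : G.M) (w : G.TΓ (G.unit m)) :
    H.TtUnit (φ.onM m) (φ.TonΓUnit m w) = φ.TonM m (G.TtUnit m w) := by
  have key : ∀ k, φ.onΓ (G.unit m) = k → ∀ v : EuclideanSpace ℝ (Fin H.dimΓ),
      (H.Tt (φ.onΓ (G.unit m)) v : EuclideanSpace ℝ (Fin H.dimM)) = H.Tt k v := by
    rintro _ rfl v; rfl
  have key' : ∀ n, G.t (G.unit m) = n → ∀ v : EuclideanSpace ℝ (Fin G.dimM),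
      (φ.TonM (G.t (G.unit m)) v : EuclideanSpace ℝ (Fin H.dimM)) = φ.TonM n v := by
    rintro _ rfl v; rfl
  exact (key _ (φ.map_unit m) _).symm.trans ((φ.map_Tt _ w).trans (key' _ (G.t_unit m) _))

theorem TsUnit_TonΓUnit (m : G.M) (w : G.TΓ (G.unit m)) :
    H.TsUnit (φ.onM m) (φ.TonΓUnit m w) = φ.TonM m (G.TsUnit m w) := by
  have key : ∀ k, φ.onΓ (G.unit m) = k → ∀ v : EuclideanSpace ℝ (Fin H.dimΓ),
      (H.Ts (φ.onΓ (G.unit m)) v : EuclideanSpace ℝ (Fin H.dimM)) = H.Ts k v := by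
    rintro _ rfl v; rfl
  have key' : ∀ n, G.s (G.unit m) = n → ∀ v : EuclideanSpace ℝ (Fin G.dimM),
      (φ.TonM (G.s (G.unit m)) v : EuclideanSpace ℝ (Fin H.dimM)) = φ.TonM n v := by
    rintro _ rfl v; rfl
  exact (key _ (φ.map_unit m) _).symm.trans ((φ.map_Ts _ w).trans (key' _ (G.s_unit m) _))

/-- The tangent space at a unit of the pull-back groupoid is a fibre product. -/
theorem existsUnique_tangent_unit (m : G.M) (x y : G.TM m) (v : H.TΓ (H.unit (φ.onM m)))
    (hx : φ.TonM m x = H.TtUnit (φ.onM m) v) (hy : φ.TonM m y = H.TsUnit (φ.onM m) v) :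
    ∃! w : G.TΓ (G.unit m), G.TtUnit m w = x ∧ G.TsUnit m w = y ∧ φ.TonΓUnit m w = v := by
  have key : ∀ k, φ.onΓ (G.unit m) = k → ∀ v : EuclideanSpace ℝ (Fin H.dimΓ),
      (H.Ts (φ.onΓ (G.unit m)) v : EuclideanSpace ℝ (Fin H.dimM)) = H.Ts k v ∧
      (H.Tt (φ.onΓ (G.unit m)) v : EuclideanSpace ℝ (Fin H.dimM)) = H.Tt k v := by
    rintro _ rfl v; exact ⟨rfl, rfl⟩
  have key' : ∀ n n', n = n' → ∀ v : EuclideanSpace ℝ (Fin G.dimM),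
      (φ.TonM n v : EuclideanSpace ℝ (Fin H.dimM)) = φ.TonM n' v := by
    rintro _ _ rfl v; rfl
  exact φ.cartesian_tangent (G.unit m) x y v
    ((key' _ _ (G.t_unit m) x).trans (hx.trans (key _ (φ.map_unit m) v).2.symm))
    ((key' _ _ (G.s_unit m) y).trans (hy.trans (key _ (φ.map_unit m) v).1.symm))

end MoritaMorphism

end LieGroupoid

namespace QuasiPoissonGroupoid

open LieGroupoid

variable {G H : LieGroupoid.{u}}

/-- Projectability of the bivector field at a unit, with the image point `onΓ (unit m)` written as
`unit (onM m)`. -/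
theorem Projects.apply_unit {φ : MoritaMorphism G H} {S : G.QuasiPoissonStructure}
    {S' : H.QuasiPoissonStructure} (h : Projects φ S S') (m : G.M)
    (ξ η : Module.Dual ℝ (H.TΓ (H.unit (φ.onM m)))) :
    S.Pi (G.unit m) ![ξ ∘ₗ φ.TonΓUnit m, η ∘ₗ φ.TonΓUnit m] =
      S'.Pi (H.unit (φ.onM m)) ![ξ, η] := by
  have key : ∀ k, φ.onΓ (G.unit m) = k →
      ∀ ζ : Fin 2 → Module.Dual ℝ (EuclideanSpace ℝ (Fin H.dimΓ)),
      S'.Pi (φ.onΓ (G.unit m)) ζ = S'.Pi k ζ := by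
    rintro _ rfl ζ; rfl
  have h₁ := (h.1 (G.unit m) ![ξ, η]).trans (key _ (φ.map_unit m) ![ξ, η])
  refine Eq.trans ?_ h₁
  congr 1
  ext i : 1
  fin_cases i <;> rfl

/-- The transpose of the differential of the base map carries the common kernel of the image onto
that of the source: covectors in `ker ρ^∨` kill the fibres of the base map, and a tangent vector
of the pull-back groupoid is determined by its images under `s_*`, `t_*` and the projection. -/
theorem Projects.map_commonKer {φ : MoritaMorphism G H} {S : G.QuasiPoissonStructure}
    {S' : H.QuasiPoissonStructure} (h : Projects φ S S') (m : G.M) :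
    (S'.Pi.commonKer (φ.onM m)).map (φ.TonM m).dualMap = S.Pi.commonKer m := by
  have hpull : ∀ α : Module.Dual ℝ (H.TM (φ.onM m)),
      sPull (G.unit m) ((φ.TonM m).dualMap α) =
        sPull (H.unit (φ.onM m)) α ∘ₗ φ.TonΓUnit m := by
    intro α
    ext w
    exact congrArg α (φ.TsUnit_TonΓUnit m w).symm
  ext β
  rw [mem_commonKer S.multiplicative]
  constructor
  · rintro ⟨α, hα, rfl⟩
    obtain ⟨h₁, h₂⟩ := (mem_commonKer S'.multiplicative _ α).1 hα
    set β := (φ.TonM m).dualMap α with hβ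
    have hts : ∀ w, β (G.TtUnit m w) = β (G.TsUnit m w) := fun w =>
      (congrArg α (φ.TtUnit_TonΓUnit m w)).symm.trans
        ((h₁ _).trans (congrArg α (φ.TsUnit_TonΓUnit m w)))
    have hst : sPull (G.unit m) β = tPull (G.unit m) β := by
      ext v; exact (hts v).symm
    refine ⟨hts, ?_⟩
    -- The vector `Π^# s^* β` vanishes, because `t_*`, `s_*` and the projection all kill it.
    set w := S.Pi.sharp (G.unit m) (sPull (G.unit m) β) with hw
    have htw : G.TtUnit m w = 0 := by
      rw [← Module.forall_dual_apply_eq_zero_iff ℝ]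
      intro γ
      have e : tPull (G.unit m) γ w = 0 := by
        rw [hw, S.Pi.apply_sharp, pairing_swap]
        exact neg_eq_zero.2 (pairing_t_s S.multiplicative (G.unit m) γ β)
      exact e
    have hsw : G.TsUnit m w = 0 := by
      rw [← Module.forall_dual_apply_eq_zero_iff ℝ]
      intro γ
      have e : sPull (G.unit m) γ w = 0 := by
        rw [hw, S.Pi.apply_sharp, hst]
        exact pairing_t_s S.multiplicative (G.unit m) β γ
      exact e
    have hφw : φ.TonΓUnit m w = 0 := by
      rw [← Module.forall_dual_apply_eq_zero_iff ℝ]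
      intro ζ
      have e : (ζ ∘ₗ φ.TonΓUnit m) w = 0 := by
        rw [hw, S.Pi.apply_sharp, hβ, hpull, h.apply_unit, pairing_swap, h₂, neg_zero]
      exact e
    have hw0 : w = 0 := by
      obtain ⟨w', -, hu⟩ := φ.existsUnique_tangent_unit m 0 0 0 (by rw [map_zero, map_zero])
        (by rw [map_zero, map_zero])
      exact (hu w ⟨htw, hsw, hφw⟩).trans
        (hu 0 ⟨map_zero _, map_zero _, map_zero _⟩).symm
    intro η
    rw [pairing_swap, ← S.Pi.apply_sharp, ← hw, hw0, map_zero, neg_zero]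
  · rintro ⟨h₁, h₂⟩
    have hsurj : Function.Surjective (φ.TonM m) := φ.submersion m
    have hfib : ∀ x, φ.TonM m x = 0 → β x = 0 := by
      intro x hx
      obtain ⟨w, ⟨ht, hs, -⟩, -⟩ := φ.existsUnique_tangent_unit m x 0 0 (by rw [hx, map_zero])
        (by rw [map_zero, map_zero])
      rw [← ht, h₁, hs, map_zero]
    obtain ⟨α, hα⟩ : ∃ α, (φ.TonM m).dualMap α = β := by
      have : β ∈ LinearMap.range (φ.TonM m).dualMap := by
        rw [LinearMap.range_dualMap_eq_dualAnnihilator_ker, Submodule.mem_dualAnnihilator]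
        exact fun x hx => hfib x hx
      exact this
    refine ⟨α, (mem_commonKer S'.multiplicative _ α).2 ⟨fun v => ?_, fun η => ?_⟩, hα⟩
    · obtain ⟨x, hx⟩ := hsurj (H.TtUnit _ v)
      obtain ⟨y, hy⟩ := hsurj (H.TsUnit _ v)
      obtain ⟨w, ⟨ht, hs, -⟩, -⟩ := φ.existsUnique_tangent_unit m x y v hx hy
      have hxy : β x = β y := by rw [← ht, h₁, hs]
      rw [← hα] at hxy
      rw [← hx, ← hy]
      exact hxy
    · rw [← h.apply_unit, ← hpull, hα]
      exact h₂ _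

theorem IsMoritaMorphism.finrank_commonKer {X Y : QuasiPoissonGroupoid.{u}}
    {φ : MoritaMorphism X.groupoid Y.groupoid} (h : X.IsMoritaMorphism Y φ) (m : X.groupoid.M) :
    Module.finrank ℝ (Y.poisson.Pi.commonKer (φ.onM m)) =
      Module.finrank ℝ (X.poisson.Pi.commonKer m) := by
  obtain ⟨T, S, -, hT, hS⟩ := h
  rw [← hT.commonKer_eq m, ← hS.map_commonKer m]
  exact (Submodule.equivMapOfInjective _
    (LinearMap.dualMap_injective_of_surjective (φ.submersion m)) _).finrank_eq

theorem IsMoritaMorphism.isNondegenerate_iff {X Y : QuasiPoissonGroupoid.{u}}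
    {φ : MoritaMorphism X.groupoid Y.groupoid} (h : X.IsMoritaMorphism Y φ) :
    X.poisson.IsNondegenerate ↔ Y.poisson.IsNondegenerate := by
  rw [QuasiPoissonStructure.isNondegenerate_iff, QuasiPoissonStructure.isNondegenerate_iff,
    φ.dim_eq, φ.surjective.forall]
  simp only [h.finrank_commonKer]

theorem MoritaEquivalent.isNondegenerate_iff {X Y : QuasiPoissonGroupoid.{u}}
    (h : MoritaEquivalent X Y) : X.poisson.IsNondegenerate ↔ Y.poisson.IsNondegenerate := by
  obtain ⟨Z, φ, ψ, hφ, hψ⟩ := h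
  exact hφ.isNondegenerate_iff.symm.trans hψ.isNondegenerate_iff

end QuasiPoissonGroupoid

/-! ### Stacks -/

theorem ShiftedPoissonStack.isNondegenerate_iff_of_isPresentedBy {𝔛 : ShiftedPoissonStack.{u}}
    {X : QuasiPoissonGroupoid.{u}} (hX : 𝔛.IsPresentedBy X) :
    𝔛.IsNondegenerate ↔ X.poisson.IsNondegenerate := by
  refine ⟨fun h => h X hX, fun h Y hY => ?_⟩
  have e : Quot.mk QuasiPoissonGroupoid.MoritaEquivalent X = Quot.mk _ Y := hX.trans hY.symm
  exact (congrArg (Quot.lift (fun Z : QuasiPoissonGroupoid.{u} => Z.poisson.IsNondegenerate)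
    fun _ _ hZ => propext hZ.isNondegenerate_iff) e).mp h

theorem mainTheorem11 (𝔛 : ShiftedPoissonStack.{u}) :
    (𝔛.IsNondegenerate → 𝔛.dim = 0) ∧
    ∀ X : QuasiPoissonGroupoid.{u}, 𝔛.IsPresentedBy X →
      (𝔛.IsNondegenerate ↔ X.poisson.IsNondegenerate) ∧
      (𝔛.IsNondegenerate ↔
        𝔛.dim = 0 ∧ ∀ x : X.groupoid.CoarseModuli, X.poisson.rank x = 0) := by
  have hrank : ∀ X : QuasiPoissonGroupoid.{u}, 𝔛.IsPresentedBy X → (𝔛.IsNondegenerate ↔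
      𝔛.dim = 0 ∧ ∀ x : X.groupoid.CoarseModuli, X.poisson.rank x = 0) := by
    rintro X hX
    rw [ShiftedPoissonStack.isNondegenerate_iff_of_isPresentedBy hX]
    have hd : 𝔛.dim = X.groupoid.dim := by subst hX; rfl
    rw [hd, LieGroupoid.QuasiPoissonStructure.isNondegenerate_iff]
    exact and_congr_right fun h => (X.poisson.forall_rank_eq_zero_iff h).symm
  refine ⟨fun h => ?_, fun X hX =>
    ⟨ShiftedPoissonStack.isNondegenerate_iff_of_isPresentedBy hX, hrank X hX⟩⟩
  obtain ⟨X, hX⟩ := Quot.exists_rep 𝔛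
  exact ((hrank X hX).1 h).1
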